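/- Let $d,k\ge 1$ and let $\mu$ be a probability measure on $\mathbb R^d$ with compact support. For a pointset $A=\{a_1,\dots,a_k\}\subset\mathbb R^d$ and a probability measure $\nu$ put $F_\nu(A)=\big(\int d^2(x,\mathrm{co}(A))\,d\nu(x)\big)^{1/2}$, where $\mathrm{co}$ denotes the convex hull and $d(\cdot,\cdot)$ the Euclidean distance. Let $A_\star$ be a minimizer of $F_\mu(A)$ over all $k$-pointsets $A\subset\mathrm{co}(\mathrm{supp}\,\mu)$. Let $x_1,x_2,\dots$ be iid samples from $\mu$, let $\mu_N=\frac1N\sum_{i\le N}\delta_{x_i}$, and for each $N\ge1$ let $A_N$ be any minimizer of $F_{\mu_N}(A)$ over all $k$-pointsets $A\subset\mathrm{co}(\{x_1,\dots,x_N\})$. Then: 1. Almost surely, $F_\mu(A_N)\to F_\mu(A_\star)$ as $N\to\infty$. 2. There is a constant $C>0$, depending only on $\mu$ (and $k$), such that for all $L>0$ and $\alpha>0$ with $\alpha\ge\min(d,2)$ there is a non-increasing function $\eta\mapsto N(\eta)\in\mathbb N$ on $(0,\infty)$ with the following property. If $\mu$ satisfies the $\alpha$-cap condition with parameters $L$ and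 $\eta>0$, that is, $$\mu\Big(\Big\{y\in\mathrm{co}(\mathrm{supp}\,\mu):\langle y,u\rangle\ge\max_{z\in\mathrm{co}(\mathrm{supp}\,\mu)}\langle z,u\rangle-\varepsilon\Big\}\Big)\ge L\varepsilon^\alpha\qquad\text{for all } u\in\mathbb S^{d-1},\ \varepsilon\in(0,\eta],$$ then for every $N>N(\eta)$, with probability at least $1-4N^{-2}$, $$F_\mu(A_N)-F_\mu(A_\star)\le C\Big(\frac{\log N}{N}\Big)^{1/\alpha}.$$ 3. In particular, if $\mu$ is supported on a convex set on which it has a density bounded from below by a positive constant, then almost surely $F_\mu(A_N)-F_\mu(A_\star)=O\big((\log N/N)^{1/d}\big)$. -/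

import Mathlib

open MeasureTheory ProbabilityTheory Filter Topology Asymptotics

universe u

/-- Euclidean space `ℝ^d`. -/
abbrev Euc (d : ℕ) : Type := EuclideanSpace ℝ (Fin d)

/-- The distance from `x` to the archetype polytope `co {a_1, …, a_k}`. -/
noncomputable def polytopeDist {d k : ℕ} (a : Fin k → Euc d) (x : Euc d) : ℝ :=
  Metric.infDist x (convexHull ℝ (Set.range a))

/-- The objective `F_ν(A) = (∫ d²(x, co A) dν(x))^{1/2}`.  A pointset is represented by a tuple;
every notion below is invariant under permutations of the tuple. -/
noncomputable def archObjective {d k : ℕ} (ν : Measure (Euc d)) (a : Fin k → Euc d) : ℝ :=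
  Real.sqrt (∫ x, polytopeDist a x ^ 2 ∂ν)

/-- The objective of the data `x_0, …, x_{N-1}`: `((1/N) ∑ i, d²(x_i, co A))^{1/2}`. -/
noncomputable def dataObjective {d k : ℕ} (x : ℕ → Euc d) (N : ℕ) (a : Fin k → Euc d) : ℝ :=
  Real.sqrt ((1 / (N : ℝ)) * ∑ i ∈ Finset.range N, polytopeDist a (x i) ^ 2)

/-- `a` solves the problem: minimize `F_ν(A)` subject to `A ⊂ co (supp ν)`. -/
def IsArchetype {d k : ℕ} (ν : Measure (Euc d)) (a : Fin k → Euc d) : Prop :=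
  (∀ l, a l ∈ convexHull ℝ ν.support) ∧
    ∀ b : Fin k → Euc d, (∀ l, b l ∈ convexHull ℝ ν.support) →
      archObjective ν a ≤ archObjective ν b

/-- `a` is an archetype pointset of the data `x_0, …, x_{N-1}`: it minimizes the data objective
subject to `A ⊂ co {x_0, …, x_{N-1}}`. -/
def IsDataArchetype {d k : ℕ} (x : ℕ → Euc d) (N : ℕ) (a : Fin k → Euc d) : Prop :=
  (∀ l, a l ∈ convexHull ℝ (x '' Set.Iio N)) ∧
    ∀ b : Fin k → Euc d, (∀ l, b l ∈ convexHull ℝ (x '' Set.Iio N)) →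
      dataObjective x N a ≤ dataObjective x N b

/-- `X_0, X_1, …` are iid samples from `μ`, defined on the probability space `(Ω, P)`. -/
structure IsIIDSample {d : ℕ} {Ω : Type*} [MeasurableSpace Ω] (μ : Measure (Euc d))
    (P : Measure Ω) (X : ℕ → Ω → Euc d) : Prop where
  indep : iIndepFun X P
  law : ∀ i, HasLaw (X i) μ P

/-- `A_N(ω)` is, for every `N ≥ 1` and `ω`, some archetype pointset of the first `N` samples
(no measurability of the choice is required). -/
def IsArchetypeChoice {d k : ℕ} {Ω : Type*} (X : ℕ → Ω → Euc d)
    (A : ℕ → Ω → Fin k → Euc d) : Prop :=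
  ∀ N, 1 ≤ N → ∀ ω, IsDataArchetype (fun i => X i ω) N (A N ω)

/-- The cap `{y ∈ co (supp ν) : ⟨y, u⟩ ≥ max_{z ∈ co (supp ν)} ⟨z, u⟩ - ε}`. -/
noncomputable def cap {d : ℕ} (ν : Measure (Euc d)) (u : Euc d) (ε : ℝ) : Set (Euc d) :=
  {y ∈ convexHull ℝ ν.support |
    sSup ((fun z => inner ℝ z u) '' convexHull ℝ ν.support) - ε ≤ inner ℝ y u}

/-- The `α`-cap condition with parameters `L` and `η`. -/
structure CapCondition {d : ℕ} (ν : Measure (Euc d)) (α L η : ℝ) : Prop where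
  alpha_pos : 0 < α
  L_pos : 0 < L
  eta_pos : 0 < η
  bounded : Bornology.IsBounded ν.support
  cap_le : ∀ ε ∈ Set.Ioc 0 η, ∀ u : Euc d, ‖u‖ = 1 → L * ε ^ α ≤ ν.real (cap ν u ε)

/-- `μ` is supported on a convex set `K` on which it has a density bounded from below by a
positive constant. -/
def HasLowerBoundedDensityOnConvex {d : ℕ} (μ : Measure (Euc d)) : Prop :=
  ∃ (K : Set (Euc d)) (f : Euc d → ENNReal) (c : ℝ), Convex ℝ K ∧ Measurable f ∧ 0 < c ∧
    (∀ x ∈ K, ENNReal.ofReal c ≤ f x) ∧ μ = (volume.restrict K).withDensity f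

/-!
Write `F = F_μ` and `F_n` for the population and the data objective, `K` for the convex hull of the
support of `μ` and `K_n` for that of the first `n` samples.

*Reduction.* Both objectives are `L²` norms of the distance to a polytope, and this distance is
`1`-Lipschitz in the archetypes, hence so are `F` and `F_n`. Since `K_n ⊆ K`, the value `F(A_n)` is
at least `F(A_⋆)`; it exceeds `F(A_⋆)` by at most the deviations of `F_n` from `F` on a net of
admissible tuples and at `A_⋆`, the scale of the net, and the distance from the points of `A_⋆` to
`K_n` (`archObjective_le_of_net`). Almost sure convergence follows from the law of large numbers on
finite nets and the density of the samples in the support.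

*Fluctuations.* A bounded nonnegative variable has variance at most a multiple of its mean. The
Chernoff bound therefore controls the deviation of `F_n²` from `F²` at the scale `τ F`, which is a
deviation of `F_n` from `F` by `τ`, with an exponent that does not depend on `F`
(`IsIIDSample.measure_objective_deviation_le`); no positive lower bound for `F` is required. Nets of
scale `1 / n` have polynomially many points (`exists_net`), so that the deviations are uniformly
`O(√(log n / n))`.

*Hulls.* Under the cap condition, the samples hit, with high probability, all caps of depth
`O((log n / n) ^ (1 / α))` over a net of directions, and then `K_n` is that close to `K` by
separation (`exists_hull_rate`). For `α ≥ 2` this error dominates the fluctuations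
(`exists_hasArchetypeRate_of_two_le`). On the line `1 ≤ α < 2` is allowed as well. There, two
archetypes fit the data exactly, and only the error of the hulls remains
(`exists_hasArchetypeRate_line`), while a single archetype is the mean, and the objective is
quadratic around its minimum (`exists_hasArchetypeRate_line_single`).

*Constants.* The constant so obtained depends on the parameters of the cap condition. It matters
only for the smallest exponent for which `μ` satisfies a cap condition, since for all larger ones a
rate of smaller order is available; one constant depending on `μ` and `k` thus suffices
(`exists_uniform_hasArchetypeRate`).

*Densities.* A density bounded from below on a convex set yields the cap condition with exponent
`d` (`HasLowerBoundedDensityOnConvex.exists_capCondition`), and the failure probabilities `4 / n²`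
are summable.
-/

/-! ### Regularity of the objective -/

lemma polytopeDist_nonneg {d k : ℕ} (a : Fin k → Euc d) (x : Euc d) : 0 ≤ polytopeDist a x :=
  Metric.infDist_nonneg

lemma continuous_polytopeDist {d k : ℕ} (a : Fin k → Euc d) : Continuous (polytopeDist a) :=
  Metric.continuous_infDist_pt _

lemma convexHull_range_nonempty {d k : ℕ} (hk : 1 ≤ k) (a : Fin k → Euc d) :
    (convexHull ℝ (Set.range a)).Nonempty :=
  ⟨a ⟨0, hk⟩, subset_convexHull ℝ _ ⟨_, rfl⟩⟩

/-- The distance to the archetype polytope is `1`-Lipschitz in the archetypes: the polytope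
of `b` lies in the convex set of points at distance at most `δ` from the polytope of `a`. -/
lemma polytopeDist_le_add {d k : ℕ} (hk : 1 ≤ k) {a b : Fin k → Euc d} {δ : ℝ}
    (h : dist a b ≤ δ) (x : Euc d) : polytopeDist a x ≤ polytopeDist b x + δ := by
  have hδ : 0 ≤ δ := dist_nonneg.trans h
  have hne := convexHull_range_nonempty hk a
  have hsub : convexHull ℝ (Set.range b) ⊆
      Metric.cthickening δ (convexHull ℝ (Set.range a)) := by
    refine convexHull_min ?_ ((convex_convexHull ℝ _).cthickening δ)
    rintro _ ⟨l, rfl⟩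
    exact Metric.mem_cthickening_of_dist_le _ (a l) _ _ (subset_convexHull ℝ _ ⟨l, rfl⟩)
      (by rw [dist_comm]; exact (dist_le_pi_dist a b l).trans h)
  rw [← sub_le_iff_le_add]
  refine (Metric.le_infDist (convexHull_range_nonempty hk b)).2 fun y hy => ?_
  have hy' : Metric.infDist y (convexHull ℝ (Set.range a)) ≤ δ := by
    have := hsub hy
    rw [Metric.mem_cthickening_iff] at this
    exact ENNReal.toReal_le_of_le_ofReal hδ this
  have := Metric.infDist_le_infDist_add_dist (s := convexHull ℝ (Set.range a)) (x := x) (y := y)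
  unfold polytopeDist
  linarith

lemma sqrt_add_le_sqrt_add {G m δ : ℝ} (hδ : 0 ≤ δ) (hm : m ^ 2 ≤ G) :
    Real.sqrt (G + 2 * δ * m + δ ^ 2) ≤ Real.sqrt G + δ := by
  have hG : 0 ≤ G := (sq_nonneg m).trans hm
  have h1 : m ≤ Real.sqrt G := Real.le_sqrt_of_sq_le hm
  refine Real.sqrt_le_iff.2 ⟨by positivity, ?_⟩
  nlinarith [Real.sq_sqrt hG, mul_le_mul_of_nonneg_left h1 hδ]

lemma polytopeDist_le {d k : ℕ} (hk : 1 ≤ k) {K : Set (Euc d)} (hK : Convex ℝ K) {D : ℝ}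
    (hD : ∀ x ∈ K, ∀ y ∈ K, dist x y ≤ D) {a : Fin k → Euc d} (ha : ∀ l, a l ∈ K)
    {x : Euc d} (hx : x ∈ K) : polytopeDist a x ≤ D := by
  obtain ⟨y, hy⟩ := convexHull_range_nonempty hk a
  refine (Metric.infDist_le_dist_of_mem hy).trans (hD x hx y ?_)
  exact convexHull_min (by rintro _ ⟨l, rfl⟩; exact ha l) hK hy

lemma ae_mem_convexHull_support {d : ℕ} (μ : Measure (Euc d)) :
    ∀ᵐ x ∂μ, x ∈ convexHull ℝ μ.support := by
  filter_upwards [Measure.support_mem_ae (μ := μ)] with x hx using subset_convexHull ℝ _ hx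

/-- For compactly supported `μ`, the distance to any polytope is almost surely bounded. -/
lemma exists_ae_polytopeDist_le {d k : ℕ} (hk : 1 ≤ k) {μ : Measure (Euc d)}
    (hμ : Bornology.IsBounded μ.support) (a : Fin k → Euc d) :
    ∃ D : ℝ, 0 ≤ D ∧ ∀ᵐ x ∂μ, polytopeDist a x ≤ D := by
  have hb : Bornology.IsBounded (convexHull ℝ (μ.support ∪ Set.range a)) :=
    isBounded_convexHull.2 (hμ.union (Set.finite_range a).isBounded)
  refine ⟨Metric.diam (convexHull ℝ (μ.support ∪ Set.range a)), Metric.diam_nonneg, ?_⟩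
  filter_upwards [Measure.support_mem_ae (μ := μ)] with x hx
  exact polytopeDist_le hk (convex_convexHull ℝ _)
    (fun x hx y hy => Metric.dist_le_diam_of_mem hb hx hy)
    (fun l => subset_convexHull ℝ _ (Or.inr ⟨l, rfl⟩)) (subset_convexHull ℝ _ (Or.inl hx))

lemma memLp_polytopeDist {d k : ℕ} (hk : 1 ≤ k) {μ : Measure (Euc d)} [IsProbabilityMeasure μ]
    (hμ : Bornology.IsBounded μ.support) (a : Fin k → Euc d) : MemLp (polytopeDist a) 2 μ := by
  obtain ⟨D, -, hD⟩ := exists_ae_polytopeDist_le hk hμ a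
  refine MemLp.of_bound (continuous_polytopeDist a).aestronglyMeasurable D ?_
  filter_upwards [hD] with x hx
  rwa [Real.norm_of_nonneg (polytopeDist_nonneg a x)]

lemma integrable_polytopeDist_sq {d k : ℕ} (hk : 1 ≤ k) {μ : Measure (Euc d)}
    [IsProbabilityMeasure μ] (hμ : Bornology.IsBounded μ.support) (a : Fin k → Euc d) :
    Integrable (fun x => polytopeDist a x ^ 2) μ :=
  (memLp_polytopeDist hk hμ a).integrable_sq

lemma archObjective_nonneg {d k : ℕ} (ν : Measure (Euc d)) (a : Fin k → Euc d) :
    0 ≤ archObjective ν a := Real.sqrt_nonneg _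

lemma dataObjective_nonneg {d k : ℕ} (x : ℕ → Euc d) (N : ℕ) (a : Fin k → Euc d) :
    0 ≤ dataObjective x N a := Real.sqrt_nonneg _

lemma archObjective_sq {d k : ℕ} (ν : Measure (Euc d)) (a : Fin k → Euc d) :
    archObjective ν a ^ 2 = ∫ x, polytopeDist a x ^ 2 ∂ν :=
  Real.sq_sqrt (integral_nonneg fun _ => sq_nonneg _)

lemma dataObjective_sq {d k : ℕ} (x : ℕ → Euc d) (N : ℕ) (a : Fin k → Euc d) :
    dataObjective x N a ^ 2 =
      (1 / (N : ℝ)) * ∑ i ∈ Finset.range N, polytopeDist a (x i) ^ 2 :=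
  Real.sq_sqrt (mul_nonneg (by positivity) (Finset.sum_nonneg fun _ _ => sq_nonneg _))

lemma archObjective_le_add {d k : ℕ} (hk : 1 ≤ k) {μ : Measure (Euc d)}
    [IsProbabilityMeasure μ] (hμ : Bornology.IsBounded μ.support) {a b : Fin k → Euc d} {δ : ℝ}
    (h : dist a b ≤ δ) : archObjective μ a ≤ archObjective μ b + δ := by
  have hδ : 0 ≤ δ := dist_nonneg.trans h
  have hb := memLp_polytopeDist hk hμ b
  have hb1 : Integrable (polytopeDist b) μ := hb.integrable (by norm_num)
  have hb2 := hb.integrable_sq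
  refine le_trans ?_ (sqrt_add_le_sqrt_add (m := ∫ x, polytopeDist b x ∂μ) hδ ?_)
  · have e : (∫ x, polytopeDist b x ^ 2 ∂μ) + 2 * δ * (∫ x, polytopeDist b x ∂μ) + δ ^ 2
        = ∫ x, (polytopeDist b x + δ) ^ 2 ∂μ := by
      have : (fun x => (polytopeDist b x + δ) ^ 2)
          = fun x => (polytopeDist b x ^ 2 + 2 * δ * polytopeDist b x) + δ ^ 2 := by
        funext x; ring
      have h12 : Integrable (fun x => polytopeDist b x ^ 2 + 2 * δ * polytopeDist b x) μ :=
        hb2.add (hb1.const_mul _)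
      rw [this, integral_add h12 (integrable_const _), integral_add hb2 (hb1.const_mul _),
        integral_const_mul]
      simp
    rw [e]
    refine Real.sqrt_le_sqrt (integral_mono (integrable_polytopeDist_sq hk hμ a) ?_ fun x => ?_)
    · exact (hb.add (memLp_const δ)).integrable_sq
    · exact pow_le_pow_left₀ (polytopeDist_nonneg _ _) (polytopeDist_le_add hk h x) 2
  · have := variance_nonneg (polytopeDist b) μ
    rw [variance_eq_sub hb] at this
    simpa using this

lemma dataObjective_le_add {d k : ℕ} (hk : 1 ≤ k) (x : ℕ → Euc d) {N : ℕ} (hN : 1 ≤ N)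
    {a b : Fin k → Euc d} {δ : ℝ} (h : dist a b ≤ δ) :
    dataObjective x N a ≤ dataObjective x N b + δ := by
  have hδ : 0 ≤ δ := dist_nonneg.trans h
  have hN' : (0 : ℝ) < N := by exact_mod_cast hN
  refine le_trans ?_ (sqrt_add_le_sqrt_add
    (m := (1 / (N : ℝ)) * ∑ i ∈ Finset.range N, polytopeDist b (x i)) hδ ?_)
  · have e : (1 / (N : ℝ)) * ∑ i ∈ Finset.range N, polytopeDist b (x i) ^ 2
        + 2 * δ * ((1 / (N : ℝ)) * ∑ i ∈ Finset.range N, polytopeDist b (x i)) + δ ^ 2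
        = (1 / (N : ℝ)) * ∑ i ∈ Finset.range N, (polytopeDist b (x i) + δ) ^ 2 := by
      have : ∀ i, (polytopeDist b (x i) + δ) ^ 2
          = (polytopeDist b (x i) ^ 2 + 2 * δ * polytopeDist b (x i)) + δ ^ 2 := by
        intro i; ring
      simp only [this, Finset.sum_add_distrib, ← Finset.mul_sum, Finset.sum_const,
        Finset.card_range, nsmul_eq_mul]
      field_simp
    rw [e]
    refine Real.sqrt_le_sqrt (mul_le_mul_of_nonneg_left (Finset.sum_le_sum fun i _ => ?_)
      (by positivity))
    exact pow_le_pow_left₀ (polytopeDist_nonneg _ _) (polytopeDist_le_add hk h _) 2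
  · have := sq_sum_le_card_mul_sum_sq (s := Finset.range N) (f := fun i => polytopeDist b (x i))
    rw [Finset.card_range] at this
    rw [mul_pow, div_pow, one_pow, div_mul_eq_mul_div, one_mul, div_mul_eq_mul_div, one_mul,
      div_le_div_iff₀ (by positivity) hN']
    nlinarith

/-! ### Comparing the two minimization problems -/

lemma convexHull_data_subset {d : ℕ} {x : ℕ → Euc d} {S : Set (Euc d)} (hx : ∀ i, x i ∈ S)
    (N : ℕ) : convexHull ℝ (x '' Set.Iio N) ⊆ convexHull ℝ S :=
  convexHull_mono (by rintro _ ⟨i, -, rfl⟩; exact hx i)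

/-- The deterministic comparison of the data problem with the population problem: `τ` bounds
the deviation of the objectives on a `δ`-net `T` of the admissible tuples, and `ε` the distance
of the optimal archetypes to the convex hull of the data. -/
lemma archObjective_le_of_net {d k : ℕ} (hk : 1 ≤ k) {μ : Measure (Euc d)}
    [IsProbabilityMeasure μ] (hμ : Bornology.IsBounded μ.support) {x : ℕ → Euc d}
    (hx : ∀ i, x i ∈ μ.support) {N : ℕ} (hN : 1 ≤ N) {A Astar : Fin k → Euc d}
    (hA : IsDataArchetype x N A) {τ δ ε : ℝ} (hε : 0 ≤ ε) {T : Set (Fin k → Euc d)}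
    (hT : ∀ a : Fin k → Euc d, (∀ l, a l ∈ convexHull ℝ μ.support) → ∃ t ∈ T, dist a t ≤ δ)
    (hTτ : ∀ t ∈ T, archObjective μ t ≤ dataObjective x N t + τ)
    (hsτ : dataObjective x N Astar ≤ archObjective μ Astar + τ)
    (hsε : ∀ l, ∃ b ∈ convexHull ℝ (x '' Set.Iio N), dist (Astar l) b ≤ ε) :
    archObjective μ A ≤ archObjective μ Astar + (2 * τ + 2 * δ + ε) := by
  choose b hb hbε using hsε
  obtain ⟨t, ht, hAt⟩ := hT A fun l => convexHull_data_subset hx N (hA.1 l)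
  have h1 := archObjective_le_add hk hμ hAt
  have h2 := hTτ t ht
  have h3 := dataObjective_le_add hk x hN ((dist_comm t A).trans_le hAt)
  have h4 := hA.2 b hb
  have h5 : dataObjective x N b ≤ dataObjective x N Astar + ε :=
    dataObjective_le_add hk x hN (by
      rw [dist_comm]; exact (dist_pi_le_iff hε).2 hbε)
  linarith

/-! ### Nets of polynomial size -/

/-- In a finite-dimensional space, the unit ball has `2⁻ʲ`-nets of size geometric in `j`: a finite
cover of the unit ball by balls of radius `1 / 2` can be iterated. -/
lemma exists_net_unitBall (E : Type*) [NormedAddCommGroup E] [NormedSpace ℝ E]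
    [FiniteDimensional ℝ E] :
    ∃ p : ℕ, ∀ j : ℕ, ∃ T : Finset E, T.card ≤ (2 ^ p) ^ j ∧
      ∀ x ∈ Metric.closedBall (0 : E) 1, ∃ t ∈ T, dist x t ≤ (1 / 2) ^ j := by
  classical
  have := FiniteDimensional.proper_real E
  obtain ⟨T₀, -, hfin, hcov⟩ := (isCompact_closedBall (0 : E) 1).finite_cover_balls
    (e := 1 / 2) (by norm_num)
  lift T₀ to Finset E using hfin
  refine ⟨T₀.card, fun j => ?_⟩
  induction j with
  | zero => exact ⟨{0}, by simp, fun x hx => ⟨0, by simp, by simpa using hx⟩⟩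
  | succ j ih =>
    obtain ⟨T, hcard, hT⟩ := ih
    refine ⟨(T ×ˢ T₀).image fun q => q.1 + ((1 / 2 : ℝ) ^ j) • q.2, ?_, fun x hx => ?_⟩
    · refine Finset.card_image_le.trans ?_
      rw [Finset.card_product, pow_succ]
      exact Nat.mul_le_mul hcard Nat.lt_two_pow_self.le
    · obtain ⟨t, ht, hxt⟩ := hT x hx
      have hpos : (0 : ℝ) < (1 / 2) ^ j := by positivity
      have hmem : ((1 / 2 : ℝ) ^ j)⁻¹ • (x - t) ∈ Metric.closedBall (0 : E) 1 := by
        rw [mem_closedBall_zero_iff, norm_smul, norm_inv, Real.norm_of_nonneg hpos.le,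
          ← dist_eq_norm, inv_mul_le_iff₀ hpos, mul_one]
        exact hxt
      obtain ⟨s, hs, hys⟩ := Set.mem_iUnion₂.1 (hcov hmem)
      refine ⟨t + ((1 / 2 : ℝ) ^ j) • s,
        Finset.mem_image.2 ⟨(t, s), Finset.mk_mem_product ht (Finset.mem_coe.1 hs), rfl⟩, ?_⟩
      have e : x - (t + ((1 / 2 : ℝ) ^ j) • s)
          = ((1 / 2 : ℝ) ^ j) • (((1 / 2 : ℝ) ^ j)⁻¹ • (x - t) - s) := by
        rw [smul_sub, smul_inv_smul₀ hpos.ne']; abel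
      rw [dist_eq_norm, e, norm_smul, Real.norm_of_nonneg hpos.le, pow_succ]
      rw [Metric.mem_ball, dist_eq_norm] at hys
      exact mul_le_mul_of_nonneg_left hys.le hpos.le

/-- A bounded set in a finite-dimensional space has nets of scale `O(1 / n)`, with centres in the
set, whose size is polynomial in `n`. -/
lemma exists_net {E : Type*} [NormedAddCommGroup E] [NormedSpace ℝ E] [FiniteDimensional ℝ E]
    {S : Set E} (hS : Bornology.IsBounded S) :
    ∃ (c : ℝ) (p : ℕ), 0 < c ∧ ∀ n : ℕ, 1 ≤ n → ∃ T : Finset E, (∀ t ∈ T, t ∈ S) ∧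
      T.card ≤ (2 * n) ^ p ∧ ∀ x ∈ S, ∃ t ∈ T, dist x t ≤ c / n := by
  classical
  obtain ⟨R, hR, hSR⟩ := hS.subset_closedBall_lt 0 (0 : E)
  obtain ⟨p, hp⟩ := exists_net_unitBall E
  refine ⟨2 * R, p, by positivity, fun n hn => ?_⟩
  obtain ⟨T, hcard, hT⟩ := hp (Nat.log 2 n + 1)
  have hn' : (0 : ℝ) < n := by exact_mod_cast hn
  have hlow : 2 ^ (Nat.log 2 n + 1) ≤ 2 * n := by
    rw [pow_succ, mul_comm]
    exact Nat.mul_le_mul_left 2 (Nat.pow_log_le_self 2 (by omega))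
  have hup : n ≤ 2 ^ (Nat.log 2 n + 1) := (Nat.lt_pow_succ_log_self (by norm_num) n).le
  have hscale : R * (1 / 2 : ℝ) ^ (Nat.log 2 n + 1) ≤ R / n := by
    rw [div_eq_mul_inv R]
    refine mul_le_mul_of_nonneg_left ?_ hR.le
    rw [one_div, inv_pow]
    exact inv_anti₀ hn' (by exact_mod_cast hup)
  have hnear : ∀ x ∈ S, ∃ t ∈ T, dist x (R • t) ≤ R / n := by
    intro x hx
    have hxR : ‖x‖ ≤ R := by simpa using hSR hx
    obtain ⟨t, ht, hxt⟩ := hT (R⁻¹ • x) (by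
      rw [mem_closedBall_zero_iff, norm_smul, norm_inv, Real.norm_of_nonneg hR.le,
        inv_mul_le_iff₀ hR, mul_one]
      exact hxR)
    refine ⟨t, ht, le_trans ?_ hscale⟩
    have e : x - R • t = R • (R⁻¹ • x - t) := by rw [smul_sub, smul_inv_smul₀ hR.ne']
    rw [dist_eq_norm, e, norm_smul, Real.norm_of_nonneg hR.le, ← dist_eq_norm]
    exact mul_le_mul_of_nonneg_left hxt hR.le
  -- Move each useful centre into `S`, at the price of doubling the scale.
  let f : E → E := fun t => if h : ∃ s ∈ S, dist s (R • t) ≤ R / n then h.choose else 0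
  have hf : ∀ t, (∃ s ∈ S, dist s (R • t) ≤ R / n) → f t ∈ S ∧ dist (f t) (R • t) ≤ R / n := by
    intro t h
    simp only [f, dif_pos h]
    exact h.choose_spec
  refine ⟨(T.filter fun t => ∃ s ∈ S, dist s (R • t) ≤ R / n).image f, ?_, ?_, fun x hx => ?_⟩
  · intro t ht
    obtain ⟨s, hs, rfl⟩ := Finset.mem_image.1 ht
    exact (hf s (Finset.mem_filter.1 hs).2).1
  · refine Finset.card_image_le.trans ((Finset.card_filter_le _ _).trans (hcard.trans ?_))
    rw [← pow_mul, mul_comm p, pow_mul]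
    exact Nat.pow_le_pow_left hlow p
  · obtain ⟨t, ht, hxt⟩ := hnear x hx
    refine ⟨f t, Finset.mem_image.2 ⟨t, Finset.mem_filter.2 ⟨ht, x, hx, hxt⟩, rfl⟩, ?_⟩
    calc dist x (f t) ≤ dist x (R • t) + dist (f t) (R • t) := dist_triangle_right _ _ _
      _ ≤ R / n + R / n := add_le_add hxt (hf t ⟨x, hx, hxt⟩).2
      _ = 2 * R / n := by ring

/-! ### Approximating the support by the convex hull of the data -/

/-- Separation: if the support function of the finite hull `co {x_0, …, x_{N-1}}` is within `ε`
of a bound valid at `a`, in every direction, then `a` is within `ε` of that hull. -/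
lemma exists_dist_le_of_forall_inner {d : ℕ} {x : ℕ → Euc d} {N : ℕ} (hN : 1 ≤ N) {a : Euc d}
    {ε : ℝ} (h : ∀ u : Euc d, ‖u‖ = 1 → ∃ i < N, inner ℝ a u - ε ≤ inner ℝ (x i) u) (hε : 0 ≤ ε) :
    ∃ b ∈ convexHull ℝ (x '' Set.Iio N), dist a b ≤ ε := by
  have hne : (convexHull ℝ (x '' Set.Iio N)).Nonempty :=
    ⟨x 0, subset_convexHull ℝ _ ⟨0, hN, rfl⟩⟩
  have hcomp : IsCompact (convexHull ℝ (x '' Set.Iio N)) :=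
    ((Set.finite_Iio N).image x).isCompact_convexHull ℝ
  obtain ⟨b, hb, hbmin⟩ := exists_norm_eq_iInf_of_complete_convex hne hcomp.isComplete
    (convex_convexHull ℝ _) a
  have hproj := (norm_eq_iInf_iff_real_inner_le_zero (convex_convexHull ℝ _) hb).1 hbmin
  refine ⟨b, hb, ?_⟩
  rcases eq_or_ne a b with rfl | hab
  · simpa using hε
  have hpos : 0 < ‖a - b‖ := norm_pos_iff.2 (sub_ne_zero.2 hab)
  obtain ⟨i, hi, hle⟩ := h (‖a - b‖⁻¹ • (a - b)) (by
    rw [norm_smul, norm_inv, norm_norm, inv_mul_cancel₀ hpos.ne'])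
  have hxi := hproj (x i) (subset_convexHull ℝ _ ⟨i, hi, rfl⟩)
  rw [inner_smul_right, inner_smul_right] at hle
  have e1 : inner ℝ a (a - b) = inner ℝ b (a - b) + ‖a - b‖ ^ 2 := by
    rw [← real_inner_self_eq_norm_sq, ← inner_add_left, add_sub_cancel]
  have e2 : inner ℝ (x i) (a - b) ≤ inner ℝ b (a - b) := by
    rw [real_inner_comm, inner_sub_left] at hxi
    linarith
  have e3 : ‖a - b‖⁻¹ * inner ℝ (x i) (a - b) ≤ ‖a - b‖⁻¹ * inner ℝ b (a - b) :=
    mul_le_mul_of_nonneg_left e2 (by positivity)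
  rw [e1, mul_add, sq, inv_mul_cancel_left₀ hpos.ne'] at hle
  rw [dist_eq_norm]
  linarith

/-! ### Samples -/

section Sample

variable {d k : ℕ} {μ : Measure (Euc d)} {Ω : Type*} [MeasurableSpace Ω] {P : Measure Ω}
  {X : ℕ → Ω → Euc d}

lemma IsIIDSample.ae_of_ae (h : IsIIDSample μ P X) {p : Euc d → Prop} (hp : ∀ᵐ x ∂μ, p x) :
    ∀ᵐ ω ∂P, ∀ i, p (X i ω) := by
  refine ae_all_iff.2 fun i => ?_
  have := (h.law i).map_eq
  rw [← this] at hp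
  exact ae_of_ae_map (h.law i).aemeasurable hp

lemma IsIIDSample.ae_mem_support (h : IsIIDSample μ P X) :
    ∀ᵐ ω ∂P, ∀ i, X i ω ∈ μ.support :=
  h.ae_of_ae (Measure.support_mem_ae (μ := μ))

lemma IsIIDSample.integral_comp (h : IsIIDSample μ P X) {f : Euc d → ℝ}
    (hf : Continuous f) (i : ℕ) : ∫ ω, f (X i ω) ∂P = ∫ x, f x ∂μ := by
  rw [← (h.law i).map_eq, integral_map (h.law i).aemeasurable hf.aestronglyMeasurable]

/-- The probability that `n` samples all miss a set of measure at least `p`. -/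
lemma IsIIDSample.measure_forall_notMem_le [IsProbabilityMeasure P] [IsProbabilityMeasure μ]
    (h : IsIIDSample μ P X)
    {S : Set (Euc d)} (hS : MeasurableSet S) {p : ℝ} (hp : p ≤ μ.real S) (n : ℕ) :
    P {ω | ∀ i < n, X i ω ∉ S} ≤ ENNReal.ofReal (Real.exp (-(n * p))) := by
  have e : {ω | ∀ i < n, X i ω ∉ S} = ⋂ i ∈ Finset.range n, X i ⁻¹' Sᶜ := by
    ext ω; simp
  have hi : ∀ i, P (X i ⁻¹' Sᶜ) = ENNReal.ofReal (1 - μ.real S) := by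
    intro i
    rw [← Measure.map_apply_of_aemeasurable (h.law i).aemeasurable hS.compl, (h.law i).map_eq,
      ← probReal_compl_eq_one_sub hS, ofReal_measureReal]
  rw [e, h.indep.measure_inter_preimage_eq_mul _ fun _ _ => hS.compl]
  simp only [hi, Finset.prod_const, Finset.card_range]
  have h0 : 0 ≤ 1 - μ.real S := sub_nonneg.2 measureReal_le_one
  rw [← ENNReal.ofReal_pow h0]
  refine ENNReal.ofReal_le_ofReal ?_
  have : 1 - μ.real S ≤ Real.exp (-p) := by
    have := Real.add_one_le_exp (-p)
    linarith
  calc (1 - μ.real S) ^ n ≤ Real.exp (-p) ^ n := pow_le_pow_left₀ h0 this n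
    _ = Real.exp (-(n * p)) := by rw [← Real.exp_nat_mul]; ring_nf

/-! ### Concentration of the objective -/

/-- A bounded nonnegative variable has variance at most a multiple of its mean, which controls
its exponential moments. -/
lemma integral_exp_mul_le [IsProbabilityMeasure μ] {f : Euc d → ℝ} (hf : Continuous f) {B : ℝ}
    (h0 : ∀ x, 0 ≤ f x) (hB : ∀ᵐ x ∂μ, f x ≤ B) {t : ℝ} (ht : |t| * B ≤ 1) :
    ∫ x, Real.exp (t * f x) ∂μ ≤
      Real.exp (t * (∫ x, f x ∂μ) + t ^ 2 * B * ∫ x, f x ∂μ) := by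
  have hfi : Integrable f μ := by
    refine Integrable.of_bound hf.aestronglyMeasurable B ?_
    filter_upwards [hB] with x hx
    rwa [Real.norm_of_nonneg (h0 x)]
  have hint : Integrable (fun x => 1 + (t + t ^ 2 * B) * f x) μ :=
    (integrable_const _).add (hfi.const_mul _)
  have hle : ∫ x, Real.exp (t * f x) ∂μ ≤ ∫ x, (1 + (t + t ^ 2 * B) * f x) ∂μ := by
    refine integral_mono_of_nonneg (ae_of_all _ fun _ => (Real.exp_pos _).le) hint ?_
    filter_upwards [hB] with x hx
    have habs : |t * f x| ≤ 1 := by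
      rw [abs_mul, abs_of_nonneg (h0 x)]
      exact (mul_le_mul_of_nonneg_left hx (abs_nonneg t)).trans ht
    have h1 := (abs_le.1 (Real.abs_exp_sub_one_sub_id_le habs)).2
    have h2 : (t * f x) ^ 2 ≤ t ^ 2 * B * f x := by
      have := mul_le_mul_of_nonneg_right hx (h0 x)
      nlinarith [mul_le_mul_of_nonneg_left this (sq_nonneg t)]
    linarith
  refine hle.trans ?_
  rw [integral_add (integrable_const _) (hfi.const_mul _), integral_const_mul]
  have := Real.add_one_le_exp (t * (∫ x, f x ∂μ) + t ^ 2 * B * ∫ x, f x ∂μ)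
  simp only [integral_const, probReal_univ, smul_eq_mul, mul_one]
  linarith

/-- A Chernoff bound, for both tails at once (`t` may have either sign). -/
lemma IsIIDSample.measure_chernoff_le [IsProbabilityMeasure P] [IsProbabilityMeasure μ]
    (h : IsIIDSample μ P X) {f : Euc d → ℝ} (hf : Continuous f) {B : ℝ}
    (h0 : ∀ x, 0 ≤ f x) (hB : ∀ᵐ x ∂μ, f x ≤ B) {t : ℝ} (ht : |t| * B ≤ 1) (n : ℕ) (r : ℝ) :
    P {ω | n * (t * (∫ x, f x ∂μ) + t ^ 2 * B * (∫ x, f x ∂μ) + r) ≤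
        t * ∑ i ∈ Finset.range n, f (X i ω)} ≤ ENNReal.ofReal (Real.exp (-(n * r))) := by
  set G := ∫ x, f x ∂μ
  have hind : iIndepFun (fun i ω => t * f (X i ω)) P :=
    h.indep.comp (fun _ x => t * f x) fun _ => (continuous_const.mul hf).measurable
  have hmeas : ∀ i, AEMeasurable (fun ω => t * f (X i ω)) P := fun i =>
    ((continuous_const.mul hf).measurable.comp_aemeasurable (h.law i).aemeasurable)
  have hmgf := hind.mgf_sum₀ (t := 1) hmeas (Finset.range n)
  have hone : ∀ i, mgf (fun ω => t * f (X i ω)) P 1 ≤ Real.exp (t * G + t ^ 2 * B * G) := by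
    intro i
    have e : mgf (fun ω => t * f (X i ω)) P 1 = ∫ x, Real.exp (t * f x) ∂μ := by
      rw [← h.integral_comp (f := fun x => Real.exp (t * f x)) (by fun_prop) i]
      simp [mgf]
    rw [e]
    exact integral_exp_mul_le hf h0 hB ht
  have hint : Integrable (fun ω => Real.exp (1 * (∑ i ∈ Finset.range n,
      (fun ω => t * f (X i ω))) ω)) P := by
    have hm : AEMeasurable (∑ i ∈ Finset.range n, (fun ω => t * f (X i ω))) P :=
      Finset.aemeasurable_sum _ fun i _ => hmeas i
    refine Integrable.of_bound (C := Real.exp n)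
      (Real.measurable_exp.comp_aemeasurable (hm.const_mul 1)).aestronglyMeasurable ?_
    filter_upwards [h.ae_of_ae hB] with ω hω
    rw [Real.norm_of_nonneg (Real.exp_pos _).le, Real.exp_le_exp, one_mul, Finset.sum_apply]
    calc ∑ i ∈ Finset.range n, t * f (X i ω) ≤ ∑ i ∈ Finset.range n, (1 : ℝ) := by
          refine Finset.sum_le_sum fun i _ => (le_abs_self _).trans ?_
          rw [abs_mul, abs_of_nonneg (h0 _)]
          exact (mul_le_mul_of_nonneg_left (hω i) (abs_nonneg t)).trans ht
      _ = n := by simp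
  have hch := measure_ge_le_exp_mul_mgf (n * (t * G + t ^ 2 * B * G + r)) zero_le_one hint
  have hset : {ω | n * (t * G + t ^ 2 * B * G + r) ≤ t * ∑ i ∈ Finset.range n, f (X i ω)}
      = {ω | n * (t * G + t ^ 2 * B * G + r) ≤
          (∑ i ∈ Finset.range n, (fun ω => t * f (X i ω))) ω} := by
    ext ω; simp [Finset.sum_apply, Finset.mul_sum]
  rw [hset, ← ofReal_measureReal]
  refine ENNReal.ofReal_le_ofReal (hch.trans ?_)
  rw [hmgf]
  calc Real.exp (-1 * (n * (t * G + t ^ 2 * B * G + r)))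
        * ∏ i ∈ Finset.range n, mgf (fun ω => t * f (X i ω)) P 1
      ≤ Real.exp (-1 * (n * (t * G + t ^ 2 * B * G + r)))
        * ∏ _i ∈ Finset.range n, Real.exp (t * G + t ^ 2 * B * G) := by
        gcongr with i _
        · exact fun i _ => mgf_nonneg
        · exact hone i
    _ = Real.exp (-(n * r)) := by
        rw [Finset.prod_const, Finset.card_range, ← Real.exp_nat_mul, ← Real.exp_add]
        ring_nf

/-- Self-normalized concentration: the *square roots* of the objectives deviate by `τ` with
Gaussian probability, uniformly in the size of the objective.  The deviation of the squares that
is needed is of order `τ F_μ(a)`, while their variance is at most `B F_μ(a)²`, so the two powers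
of `F_μ(a)` cancel in the Chernoff exponent for the choice `t = ± τ / (2 B F_μ(a))`. -/
lemma IsIIDSample.measure_objective_deviation_le [IsProbabilityMeasure P]
    [IsProbabilityMeasure μ] (h : IsIIDSample μ P X) (a : Fin k → Euc d) {B : ℝ} (hBpos : 0 < B)
    (hB : ∀ᵐ x ∂μ, polytopeDist a x ^ 2 ≤ B) {τ : ℝ} (hτ : 0 < τ) {n : ℕ} (hn : 1 ≤ n) :
    P {ω | ¬ (archObjective μ a ≤ dataObjective (fun i => X i ω) n a + τ ∧
        dataObjective (fun i => X i ω) n a ≤ archObjective μ a + τ)} ≤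
      ENNReal.ofReal (2 * Real.exp (-(n * (τ ^ 2 / (4 * B))))) := by
  have hn' : (0 : ℝ) < n := by exact_mod_cast hn
  set F := archObjective μ a with hF
  have hF0 : 0 ≤ F := archObjective_nonneg μ a
  have hG : ∫ x, polytopeDist a x ^ 2 ∂μ = F ^ 2 := (archObjective_sq μ a).symm
  have hcont : Continuous fun x => polytopeDist a x ^ 2 := (continuous_polytopeDist a).pow 2
  have hsum : ∀ ω, ∑ i ∈ Finset.range n, polytopeDist a (X i ω) ^ 2
      = n * dataObjective (fun i => X i ω) n a ^ 2 := by
    intro ω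
    rw [dataObjective_sq]
    field_simp
  have key : ∀ t : ℝ, |t| * B ≤ 1 →
      P {ω | t * F ^ 2 + t ^ 2 * B * F ^ 2 + τ ^ 2 / (4 * B)
        ≤ t * dataObjective (fun i => X i ω) n a ^ 2}
        ≤ ENNReal.ofReal (Real.exp (-(n * (τ ^ 2 / (4 * B))))) := by
    intro t ht
    have := h.measure_chernoff_le hcont (fun _ => sq_nonneg _) hB ht n (τ ^ 2 / (4 * B))
    rw [hG] at this
    refine le_trans (measure_mono fun ω hω => ?_) this
    simp only [Set.mem_ofPred_eq] at hω ⊢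
    rw [hsum]
    have := mul_le_mul_of_nonneg_left hω hn'.le
    linarith
  have hlow : P {ω | ¬ F ≤ dataObjective (fun i => X i ω) n a + τ}
      ≤ ENNReal.ofReal (Real.exp (-(n * (τ ^ 2 / (4 * B))))) := by
    rcases le_or_gt F τ with hFτ | hFτ
    · have : {ω | ¬ F ≤ dataObjective (fun i => X i ω) n a + τ} = ∅ := by
        ext ω
        have := dataObjective_nonneg (fun i => X i ω) n a
        simp only [Set.mem_ofPred_eq, Set.mem_empty_iff_false, iff_false, not_not]
        linarith
      rw [this, measure_empty]
      exact zero_le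
    · have hFpos : 0 < F := hτ.trans hFτ
      refine le_trans (measure_mono fun ω hω => ?_) (key (-(τ / (2 * B * F))) ?_)
      · simp only [Set.mem_ofPred_eq, not_le] at hω ⊢
        set D := dataObjective (fun i => X i ω) n a
        have hD : 0 ≤ D := dataObjective_nonneg _ n a
        have h1 : D ^ 2 ≤ F ^ 2 - F * τ := by nlinarith
        have h2 : τ / (2 * B * F) * D ^ 2 ≤ τ / (2 * B * F) * (F ^ 2 - F * τ) :=
          mul_le_mul_of_nonneg_left h1 (by positivity)
        have h3 : τ / (2 * B * F) * (F ^ 2 - F * τ) = τ / (2 * B * F) * F ^ 2 - τ ^ 2 / (2 * B) := by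
          field_simp
        have h4 : (-(τ / (2 * B * F))) ^ 2 * B * F ^ 2 + τ ^ 2 / (4 * B) = τ ^ 2 / (2 * B) := by
          field_simp; norm_num
        linarith
      · rw [abs_neg, abs_of_nonneg (by positivity)]
        have : τ / (2 * B * F) * B = τ / (2 * F) := by field_simp
        rw [this, div_le_one (by positivity)]
        linarith
  have hup : P {ω | ¬ dataObjective (fun i => X i ω) n a ≤ F + τ}
      ≤ ENNReal.ofReal (Real.exp (-(n * (τ ^ 2 / (4 * B))))) := by
    rcases le_or_gt (τ / 2) F with hFτ | hFτ
    · have hFpos : 0 < F := (by positivity : 0 < τ / 2).trans_le hFτ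
      refine le_trans (measure_mono fun ω hω => ?_) (key (τ / (2 * B * F)) ?_)
      · simp only [Set.mem_ofPred_eq, not_le] at hω ⊢
        set D := dataObjective (fun i => X i ω) n a
        have h1 : F ^ 2 + 2 * F * τ ≤ D ^ 2 := by nlinarith
        have h2 : τ / (2 * B * F) * (F ^ 2 + 2 * F * τ) ≤ τ / (2 * B * F) * D ^ 2 :=
          mul_le_mul_of_nonneg_left h1 (by positivity)
        have h3 : τ / (2 * B * F) * (F ^ 2 + 2 * F * τ)
            = τ / (2 * B * F) * F ^ 2 + τ ^ 2 / (2 * B) + τ ^ 2 / (2 * B) := by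
          field_simp; ring
        have h4 : (τ / (2 * B * F)) ^ 2 * B * F ^ 2 + τ ^ 2 / (4 * B) = τ ^ 2 / (2 * B) := by
          field_simp; norm_num
        have h5 : 0 ≤ τ ^ 2 / (2 * B) := by positivity
        linarith
      · rw [abs_of_nonneg (by positivity)]
        have : τ / (2 * B * F) * B = τ / (2 * F) := by field_simp
        rw [this, div_le_one (by positivity)]
        linarith
    · -- For tiny objectives the largest admissible exponent `1 / B` does the work.
      refine le_trans (measure_mono fun ω hω => ?_) (key (1 / B) ?_)
      · simp only [Set.mem_ofPred_eq, not_le] at hω ⊢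
        set D := dataObjective (fun i => X i ω) n a
        have h1 : F ^ 2 + F ^ 2 + τ ^ 2 / 4 ≤ D ^ 2 := by nlinarith
        have h2 := mul_le_mul_of_nonneg_left h1 (by positivity : 0 ≤ 1 / B)
        have h3 : 1 / B * (F ^ 2 + F ^ 2 + τ ^ 2 / 4)
            = 1 / B * F ^ 2 + (1 / B) ^ 2 * B * F ^ 2 + τ ^ 2 / (4 * B) := by
          field_simp
        linarith
      · rw [abs_of_nonneg (by positivity)]
        field_simp
        exact le_rfl
  calc _ ≤ P ({ω | ¬ F ≤ dataObjective (fun i => X i ω) n a + τ} ∪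
        {ω | ¬ dataObjective (fun i => X i ω) n a ≤ F + τ}) := by
        refine measure_mono fun ω hω => ?_
        simp only [Set.mem_ofPred_eq, Set.mem_union] at hω ⊢
        tauto
    _ ≤ _ := (measure_union_le _ _).trans (add_le_add hlow hup)
    _ = _ := by
        rw [← ENNReal.ofReal_add (Real.exp_pos _).le (Real.exp_pos _).le, two_mul]

end Sample

/-! ### Almost sure convergence -/

section Consistency

variable {d k : ℕ} {μ : Measure (Euc d)} [IsProbabilityMeasure μ] {Ω : Type*} [MeasurableSpace Ω]
  {P : Measure Ω} {X : ℕ → Ω → Euc d}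

lemma IsIIDSample.ae_tendsto_dataObjective (h : IsIIDSample μ P X) (hk : 1 ≤ k)
    (hμ : Bornology.IsBounded μ.support) (a : Fin k → Euc d) :
    ∀ᵐ ω ∂P, Tendsto (fun n => dataObjective (fun i => X i ω) n a) atTop
      (𝓝 (archObjective μ a)) := by
  have hcont : Continuous fun x => polytopeDist a x ^ 2 := (continuous_polytopeDist a).pow 2
  have hint : Integrable (fun ω => polytopeDist a (X 0 ω) ^ 2) P := by
    have := integrable_polytopeDist_sq hk hμ a
    rw [← (h.law 0).map_eq] at this
    exact this.comp_aemeasurable (h.law 0).aemeasurable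
  have hident : ∀ i, IdentDistrib (fun ω => polytopeDist a (X i ω) ^ 2)
      (fun ω => polytopeDist a (X 0 ω) ^ 2) P P := fun i =>
    IdentDistrib.comp ⟨(h.law i).aemeasurable, (h.law 0).aemeasurable,
      (h.law i).map_eq.trans (h.law 0).map_eq.symm⟩ hcont.measurable
  have hlaw := strong_law_ae_real (fun i ω => polytopeDist a (X i ω) ^ 2) hint
    (fun i j hij => (h.indep.indepFun hij).comp hcont.measurable hcont.measurable) hident
  filter_upwards [hlaw] with ω hω
  rw [h.integral_comp hcont 0] at hω
  refine ((Real.continuous_sqrt.tendsto _).comp hω).congr fun n => ?_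
  simp only [Function.comp_apply, dataObjective]
  rw [div_eq_inv_mul, one_div]

/-- Almost surely, the samples are dense in the support. -/
lemma IsIIDSample.ae_support_subset_closure [IsProbabilityMeasure P] (h : IsIIDSample μ P X) :
    ∀ᵐ ω ∂P, μ.support ⊆ closure (Set.range fun i => X i ω) := by
  have hbasis : ∀ U ∈ TopologicalSpace.countableBasis (Euc d), 0 < μ U →
      ∀ᵐ ω ∂P, ∃ i, X i ω ∈ U := by
    intro U hU hpos
    have hm : MeasurableSet U :=
      (TopologicalSpace.isOpen_of_mem_countableBasis hU).measurableSet
    have hp : 0 < μ.real U := ENNReal.toReal_pos hpos.ne' (measure_ne_top _ _)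
    have hle : ∀ n : ℕ, P {ω | ¬ ∃ i, X i ω ∈ U} ≤
        ENNReal.ofReal (Real.exp (-(n * μ.real U))) := fun n =>
      (measure_mono fun ω hω => by
        simp only [Set.mem_ofPred_eq, not_exists] at hω ⊢
        exact fun i _ => hω i).trans (h.measure_forall_notMem_le hm le_rfl n)
    have hlim : Tendsto (fun n : ℕ => ENNReal.ofReal (Real.exp (-(n * μ.real U)))) atTop
        (𝓝 0) := by
      rw [← ENNReal.ofReal_zero]
      refine ENNReal.tendsto_ofReal (Real.tendsto_exp_atBot.comp ?_)
      exact tendsto_neg_atTop_atBot.comp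
        (tendsto_natCast_atTop_atTop.atTop_mul_const hp)
    exact ae_iff.2 (le_antisymm (ge_of_tendsto' hlim hle) zero_le)
  have hall : ∀ᵐ ω ∂P, ∀ U ∈ TopologicalSpace.countableBasis (Euc d), 0 < μ U →
      ∃ i, X i ω ∈ U := by
    refine (ae_ball_iff (TopologicalSpace.countable_countableBasis _)).2 fun U hU => ?_
    by_cases hpos : 0 < μ U
    · filter_upwards [hbasis U hU hpos] with ω hω _ using hω
    · exact ae_of_all _ fun ω hpos' => absurd hpos' hpos
  filter_upwards [hall] with ω hω s hs
  refine (TopologicalSpace.isBasis_countableBasis (Euc d)).mem_closure_iff.2 fun U hU hsU => ?_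
  have hUo : IsOpen U := TopologicalSpace.isOpen_of_mem_countableBasis hU
  obtain ⟨i, hi⟩ := hω U hU ((Measure.mem_support_iff_forall s).1 hs U (hUo.mem_nhds hsU))
  exact ⟨_, hi, i, rfl⟩

/-- If the data are dense in `S`, then every point of `co S` is eventually close to the convex
hull of the data. -/
lemma eventually_exists_dist_le {x : ℕ → Euc d} {S : Set (Euc d)}
    (hS : S ⊆ closure (Set.range x)) {a : Euc d} (ha : a ∈ convexHull ℝ S) {ε : ℝ}
    (hε : 0 < ε) :
    ∀ᶠ n in atTop, ∃ b ∈ convexHull ℝ (x '' Set.Iio n), dist a b ≤ ε := by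
  have hmono : Monotone fun n : ℕ => convexHull ℝ (x '' Set.Iio n) := fun m n hmn =>
    convexHull_mono (Set.image_mono (Set.Iio_subset_Iio hmn))
  have hsub : convexHull ℝ S ⊆ closure (⋃ n, convexHull ℝ (x '' Set.Iio n)) := by
    have hconv : Convex ℝ (⋃ n, convexHull ℝ (x '' Set.Iio n)) :=
      hmono.directed_le.convex_iUnion fun n => convex_convexHull ℝ _
    refine convexHull_min (hS.trans (closure_mono ?_)) hconv.closure
    rintro _ ⟨i, rfl⟩
    exact Set.mem_iUnion.2 ⟨i + 1, subset_convexHull ℝ _ ⟨i, Nat.lt_succ_self i, rfl⟩⟩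
  obtain ⟨b, hb, hab⟩ := Metric.mem_closure_iff.1 (hsub ha) ε hε
  obtain ⟨m, hm⟩ := Set.mem_iUnion.1 hb
  filter_upwards [eventually_ge_atTop m] with n hn
  exact ⟨b, hmono hn hm, hab.le⟩

lemma isBounded_admissible {K : Set (Euc d)} (hK : Bornology.IsBounded K) :
    Bornology.IsBounded {a : Fin k → Euc d | ∀ l, a l ∈ K} := by
  have : {a : Fin k → Euc d | ∀ l, a l ∈ K} = Set.univ.pi fun _ => K := by
    ext a; simp [Set.mem_pi]
  rw [this]
  exact Bornology.IsBounded.pi fun _ => hK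

/-- Almost surely, the optimal values converge: on a finite net of admissible tuples the objectives
converge by the law of large numbers, and the convex hull of the data approaches the optimal
archetypes. -/
lemma IsIIDSample.ae_tendsto_archObjective [IsProbabilityMeasure P] (h : IsIIDSample μ P X) (hk : 1 ≤ k)
    (hμ : Bornology.IsBounded μ.support) {Astar : Fin k → Euc d} (hstar : IsArchetype μ Astar)
    {A : ℕ → Ω → Fin k → Euc d} (hA : IsArchetypeChoice X A) :
    ∀ᵐ ω ∂P, Tendsto (fun N => archObjective μ (A N ω)) atTop
      (𝓝 (archObjective μ Astar)) := by
  obtain ⟨c, p, hc, hnet⟩ := exists_net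
    (isBounded_admissible (k := k) (isBounded_convexHull.2 hμ))
  choose T hTmem hTcard hT using fun n : ℕ => hnet (n + 1) (by omega)
  have hlln : ∀ᵐ ω ∂P, ∀ n, ∀ t ∈ T n, Tendsto (fun m => dataObjective (fun i => X i ω) m t)
      atTop (𝓝 (archObjective μ t)) :=
    ae_all_iff.2 fun n => (ae_ball_iff (T n).countable_toSet).2 fun t _ =>
      h.ae_tendsto_dataObjective hk hμ t
  filter_upwards [hlln, h.ae_tendsto_dataObjective hk hμ Astar, h.ae_support_subset_closure,
    h.ae_mem_support] with ω hω hωstar hdense hmem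
  rw [Metric.tendsto_atTop']
  intro e he
  obtain ⟨n, hn⟩ := exists_nat_gt (8 * c / e)
  have hn1 : (0 : ℝ) < ((n + 1 : ℕ) : ℝ) := by positivity
  have hδ : c / ((n + 1 : ℕ) : ℝ) ≤ e / 8 := by
    rw [div_le_iff₀ hn1]
    rw [div_lt_iff₀ he] at hn
    push_cast
    nlinarith
  have hev1 : ∀ᶠ m in atTop, ∀ t ∈ T n,
      archObjective μ t ≤ dataObjective (fun i => X i ω) m t + e / 8 := by
    refine (Finset.eventually_all (T n)).2 fun t ht => ?_
    filter_upwards [(hω n t ht).eventually (lt_mem_nhds (show archObjective μ t - e / 8 <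
      archObjective μ t by linarith))] with m hm
    linarith
  have hev2 := hωstar.eventually (gt_mem_nhds (show archObjective μ Astar <
    archObjective μ Astar + e / 8 by linarith))
  have hev3 : ∀ᶠ m in atTop, ∀ l, ∃ b ∈ convexHull ℝ ((fun i => X i ω) '' Set.Iio m),
      dist (Astar l) b ≤ e / 8 :=
    eventually_all.2 fun l => eventually_exists_dist_le hdense (hstar.1 l) (by linarith)
  obtain ⟨m₀, hm₀⟩ := eventually_atTop.1 ((hev1.and (hev2.and hev3)).and (eventually_ge_atTop 1))
  refine ⟨m₀, fun m hm => ?_⟩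
  obtain ⟨⟨h1, h2, h3⟩, hm1⟩ := hm₀ m hm.le
  have hle := archObjective_le_of_net hk hμ hmem hm1 (hA m hm1 ω) (by positivity) (hT n) h1 h2.le h3
  have hge := hstar.2 (A m ω) fun l => convexHull_data_subset hmem m ((hA m hm1 ω).1 l)
  rw [Real.dist_eq, abs_lt]
  constructor <;> linarith

end Consistency

/-! ### The rate `(log n / n) ^ (1 / α)` -/

lemma one_le_log_natCast {n : ℕ} (hn : 3 ≤ n) : 1 ≤ Real.log n := by
  rw [Real.le_log_iff_exp_le (by positivity)]
  have h3 : (3 : ℝ) ≤ n := by exact_mod_cast hn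
  exact (Real.exp_one_lt_d9.le.trans (by norm_num)).trans h3

lemma log_div_le_one (n : ℕ) : Real.log n / n ≤ 1 :=
  div_le_one_of_le₀ (Real.log_le_self (Nat.cast_nonneg n)) (Nat.cast_nonneg n)

lemma log_div_pos {n : ℕ} (hn : 3 ≤ n) : 0 < Real.log n / n :=
  div_pos (one_pos.trans_le (one_le_log_natCast hn)) (by positivity)

lemma log_div_nonneg (n : ℕ) : 0 ≤ Real.log n / n :=
  div_nonneg (Real.log_natCast_nonneg n) (Nat.cast_nonneg n)

lemma tendsto_log_div : Tendsto (fun n : ℕ => Real.log n / n) atTop (𝓝 0) :=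
  (Real.isLittleO_log_id_atTop.tendsto_div_nhds_zero).comp tendsto_natCast_atTop_atTop

lemma tendsto_log_div_rpow {r : ℝ} (hr : 0 < r) :
    Tendsto (fun n : ℕ => (Real.log n / n) ^ r) atTop (𝓝 0) := by
  simpa [Real.zero_rpow hr.ne'] using
    tendsto_log_div.rpow_const (p := r) (Or.inr hr.le)

/-- Smaller exponents dominate. -/
lemma log_div_rpow_le {n : ℕ} (hn : 3 ≤ n) {r s : ℝ} (h : r ≤ s) :
    (Real.log n / n) ^ s ≤ (Real.log n / n) ^ r :=
  Real.rpow_le_rpow_of_exponent_ge (log_div_pos hn) (log_div_le_one n) h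

lemma log_div_le_rpow {n : ℕ} (hn : 3 ≤ n) {α : ℝ} (hα : 1 ≤ α) :
    Real.log n / n ≤ (Real.log n / n) ^ (1 / α) := by
  have := log_div_rpow_le hn (r := 1 / α) (s := 1) (by
    rw [div_le_one (by linarith)]; exact hα)
  rwa [Real.rpow_one] at this

lemma inv_le_rpow {n : ℕ} (hn : 3 ≤ n) {α : ℝ} (hα : 1 ≤ α) :
    1 / (n : ℝ) ≤ (Real.log n / n) ^ (1 / α) :=
  (div_le_div_of_nonneg_right (one_le_log_natCast hn) (Nat.cast_nonneg n)).trans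
    (log_div_le_rpow hn hα)

/-- The union bound over a net of polynomial size. -/
lemma measure_biUnion_net_le {Ω ι : Type*} [MeasurableSpace Ω] (P : Measure Ω) {n p : ℕ}
    (hn : 2 ≤ n) (T : Finset ι) (hT : T.card ≤ (2 * n) ^ p) (s : ι → Set Ω)
    (hs : ∀ t ∈ T, P (s t) ≤
      ENNReal.ofReal (2 * Real.exp (-((2 * p + 3 : ℕ) * Real.log n)))) :
    P (⋃ t ∈ T, s t) ≤ ENNReal.ofReal (1 / (n : ℝ) ^ 2) := by
  have hn2 : (2 : ℝ) ≤ n := by exact_mod_cast hn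
  have hn0 : (0 : ℝ) < n := by linarith
  have hexp : Real.exp (-((2 * p + 3 : ℕ) * Real.log n)) = 1 / (n : ℝ) ^ (2 * p + 3) := by
    rw [Real.exp_neg, Real.exp_nat_mul, Real.exp_log hn0, one_div]
  calc P (⋃ t ∈ T, s t) ≤ ∑ t ∈ T, P (s t) := measure_biUnion_finset_le _ _
    _ ≤ ∑ _t ∈ T, ENNReal.ofReal (2 * (1 / (n : ℝ) ^ (2 * p + 3))) :=
        Finset.sum_le_sum fun t ht => by rw [← hexp]; exact hs t ht
    _ = ENNReal.ofReal (T.card * (2 * (1 / (n : ℝ) ^ (2 * p + 3)))) := by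
        rw [Finset.sum_const, nsmul_eq_mul, ENNReal.ofReal_mul (Nat.cast_nonneg _),
          ENNReal.ofReal_natCast]
    _ ≤ ENNReal.ofReal (1 / (n : ℝ) ^ 2) := by
        refine ENNReal.ofReal_le_ofReal ?_
        have hcard : (T.card : ℝ) ≤ (n : ℝ) ^ (2 * p) := by
          have h1 : (T.card : ℝ) ≤ (2 * n : ℝ) ^ p := by exact_mod_cast hT
          rw [pow_mul]
          exact h1.trans (pow_le_pow_left₀ (by positivity) (by nlinarith) p)
        calc (T.card : ℝ) * (2 * (1 / (n : ℝ) ^ (2 * p + 3)))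
            ≤ (n : ℝ) ^ (2 * p) * (n * (1 / (n : ℝ) ^ (2 * p + 3))) := by gcongr
          _ = 1 / (n : ℝ) ^ 2 := by
            rw [pow_add (n : ℝ) (2 * p) 3]
            field_simp

/-- Under the cap condition, the convex hull of `n` samples is, with probability at least
`1 - n⁻²`, within Hausdorff distance `O((log n / n) ^ (1 / α))` of the convex hull of the support:
with high probability the samples hit all caps of that depth over a net of directions. -/
lemma exists_hull_rate {d : ℕ} {μ : Measure (Euc d)} [IsProbabilityMeasure μ] {α L η : ℝ}
    (hα : 1 ≤ α) (hcap : CapCondition μ α L η) :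
    ∃ (C : ℝ) (N : ℕ), 0 < C ∧ ∀ (Ω : Type u) [MeasurableSpace Ω] (P : Measure Ω)
      [IsProbabilityMeasure P] (X : ℕ → Ω → Euc d), IsIIDSample μ P X → ∀ n : ℕ, N < n →
      P {ω | ¬ ∀ a ∈ convexHull ℝ μ.support,
          ∃ b ∈ convexHull ℝ ((fun i => X i ω) '' Set.Iio n),
            dist a b ≤ C * (Real.log n / n) ^ (1 / α)} ≤ ENNReal.ofReal (1 / (n : ℝ) ^ 2) := by
  have hα0 : 0 < α := by linarith
  have hL := hcap.L_pos
  obtain ⟨R, hR, hKR⟩ := (isBounded_convexHull.2 hcap.bounded).subset_closedBall_lt 0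
    (0 : Euc d)
  have hnorm : ∀ x ∈ convexHull ℝ μ.support, ‖x‖ ≤ R := fun x hx => by simpa using hKR hx
  obtain ⟨c, p, hc, hnet⟩ := exists_net (S := {u : Euc d | ‖u‖ = 1})
    ((Metric.isBounded_sphere (x := (0 : Euc d)) (r := 1)).subset fun u hu =>
      mem_sphere_zero_iff_norm.2 hu)
  set M : ℕ := 2 * p + 3
  have hM : (0 : ℝ) < M := by positivity
  -- A cap of depth `C₁ (log n / n) ^ (1 / α)` has measure at least `M log n / n`.
  set C₁ : ℝ := (M / L) ^ (1 / α)
  have hC₁ : 0 < C₁ := by positivity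
  have hsmall : ∀ᶠ n : ℕ in atTop, C₁ * (Real.log n / n) ^ (1 / α) < η := by
    have := (tendsto_log_div_rpow (r := 1 / α) (by positivity)).const_mul C₁
    rw [mul_zero] at this
    exact this.eventually (gt_mem_nhds hcap.eta_pos)
  obtain ⟨N, hN⟩ := eventually_atTop.1 hsmall
  refine ⟨C₁ + 2 * R * c, max N 3, by positivity, ?_⟩
  intro Ω _ P _ X hX n hn
  have hn3 : 3 ≤ n := (le_max_right _ _).trans hn.le
  have hn0 : (0 : ℝ) < n := by positivity
  have ht : 0 < Real.log n / n := log_div_pos hn3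
  set ε : ℝ := C₁ * (Real.log n / n) ^ (1 / α) with hε
  have hε0 : 0 < ε := by positivity
  have hεη : ε ≤ η := (hN n ((le_max_left _ _).trans hn.le)).le
  have hεα : L * ε ^ α = M * (Real.log n / n) := by
    rw [hε, Real.mul_rpow hC₁.le (by positivity), ← Real.rpow_mul (by positivity),
      ← Real.rpow_mul (by positivity), one_div_mul_cancel hα0.ne', Real.rpow_one, Real.rpow_one]
    field_simp
  obtain ⟨T, hTmem, hTcard, hT⟩ := hnet n (by omega)
  let h : Euc d → ℝ := fun u => sSup ((fun z => inner ℝ z u) '' convexHull ℝ μ.support)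
  have hle : ∀ u : Euc d, ∀ a ∈ convexHull ℝ μ.support, inner ℝ a u ≤ h u := by
    intro u a ha
    refine le_csSup ⟨R * ‖u‖, ?_⟩ ⟨a, ha, rfl⟩
    rintro _ ⟨z, hz, rfl⟩
    exact (real_inner_le_norm z u).trans
      (mul_le_mul_of_nonneg_right (hnorm z hz) (norm_nonneg u))
  let H : Euc d → Set (Euc d) := fun u => {y | h u - ε ≤ inner ℝ y u}
  have hHmeas : ∀ u, MeasurableSet (H u) := fun u =>
    (isClosed_le continuous_const (by fun_prop)).measurableSet
  have hmiss := measure_biUnion_net_le P (by omega : 2 ≤ n) T hTcard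
    (fun u => {ω | ∀ i < n, X i ω ∉ H u}) (by
      intro u hu
      have hcapu : M * (Real.log n / n) ≤ μ.real (H u) := by
        rw [← hεα]
        exact (hcap.cap_le ε ⟨hε0, hεη⟩ u (hTmem u hu)).trans
          (measureReal_mono fun y hy => hy.2)
      refine (hX.measure_forall_notMem_le (hHmeas u) hcapu n).trans
        (ENNReal.ofReal_le_ofReal ?_)
      have e : (n : ℝ) * (M * (Real.log n / n)) = M * Real.log n := by field_simp
      rw [e]
      linarith [Real.exp_pos (-(M * Real.log n))])
  refine le_trans (measure_mono_ae ?_) hmiss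
  filter_upwards [hX.ae_mem_support] with ω hω hbad
  have hbad' : ¬ ∀ a ∈ convexHull ℝ μ.support,
          ∃ b ∈ convexHull ℝ ((fun i => X i ω) '' Set.Iio n),
            dist a b ≤ (C₁ + 2 * R * c) * (Real.log n / n) ^ (1 / α) := hbad
  by_contra hnot
  apply hbad'
  intro a ha
  have hhit : ∀ u ∈ T, ∃ i < n, X i ω ∈ H u := by
    intro u hu
    by_contra hcon
    push Not at hcon
    exact hnot (Set.mem_iUnion₂.2 ⟨u, hu, hcon⟩)
  have hsum : ε + 2 * R * (c / n) ≤ (C₁ + 2 * R * c) * (Real.log n / n) ^ (1 / α) := by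
    have := mul_le_mul_of_nonneg_left (inv_le_rpow hn3 hα) (by positivity : 0 ≤ 2 * R * c)
    rw [add_mul]
    have e : 2 * R * (c / n) = 2 * R * c * (1 / n) := by ring
    linarith
  obtain ⟨b, hb, hab⟩ := exists_dist_le_of_forall_inner (x := fun i => X i ω) (N := n)
    (by omega) (a := a) (ε := ε + 2 * R * (c / n)) (by
      intro u hu
      obtain ⟨t, htT, hut⟩ := hT u hu
      obtain ⟨i, hi, hit⟩ := hhit t htT
      refine ⟨i, hi, ?_⟩
      have hdiff : ∀ y ∈ convexHull ℝ μ.support, |inner ℝ y u - inner ℝ y t| ≤ R * (c / n) := by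
        intro y hy
        rw [← inner_sub_right]
        refine (abs_real_inner_le_norm _ _).trans ?_
        rw [← dist_eq_norm]
        exact mul_le_mul (hnorm y hy) hut dist_nonneg hR.le
      have h1 := (abs_le.1 (hdiff a ha)).2
      have h2 := (abs_le.1 (hdiff (X i ω) (subset_convexHull ℝ _ (hω i)))).1
      have h3 : h t - ε ≤ inner ℝ (X i ω) t := hit
      have h4 := hle t a ha
      linarith) (by positivity)
  exact ⟨b, hb, hab.trans hsum⟩

/-- The optimal value of the data problem converges at the rate `C (log n / n) ^ (1 / α)`, with
the (outer) probability of failure at most `4 / n ^ 2`, for all large `n`. -/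
def HasArchetypeRate {d k : ℕ} (μ : Measure (Euc d)) (Astar : Fin k → Euc d) (α C : ℝ) : Prop :=
  ∃ N : ℕ, ∀ (Ω : Type u) [MeasurableSpace Ω] (P : Measure Ω) [IsProbabilityMeasure P]
    (X : ℕ → Ω → Euc d) (A : ℕ → Ω → Fin k → Euc d),
    IsIIDSample μ P X → IsArchetypeChoice X A → ∀ n : ℕ, N < n →
      P {ω | ¬ (archObjective μ (A n ω) - archObjective μ Astar
        ≤ C * (Real.log n / n) ^ (1 / α))} ≤ ENNReal.ofReal (4 / (n : ℝ) ^ 2)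

/-- The rate for `α ≥ 2`, where it dominates the fluctuations `√(log n / n)` of the objective. -/
lemma exists_hasArchetypeRate_of_two_le {d k : ℕ} (hk : 1 ≤ k) {μ : Measure (Euc d)}
    [IsProbabilityMeasure μ] {Astar : Fin k → Euc d} (hstar : IsArchetype μ Astar) {α L η : ℝ}
    (hα : 2 ≤ α) (hcap : CapCondition μ α L η) :
    ∃ C, 0 < C ∧ HasArchetypeRate.{u} μ Astar α C := by
  have hα1 : 1 ≤ α := by linarith
  have hμ := hcap.bounded
  obtain ⟨C, N, hC, hhull⟩ := exists_hull_rate.{u} hα1 hcap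
  obtain ⟨c, p, hc, hnet⟩ := exists_net
    (isBounded_admissible (k := k) (isBounded_convexHull.2 hμ))
  set D : ℝ := Metric.diam (convexHull ℝ μ.support) + 1
  have hD : 0 < D := by positivity
  have hB : ∀ a : Fin k → Euc d, (∀ l, a l ∈ convexHull ℝ μ.support) →
      ∀ᵐ x ∂μ, polytopeDist a x ^ 2 ≤ D ^ 2 := by
    intro a ha
    filter_upwards [ae_mem_convexHull_support μ] with x hx
    refine pow_le_pow_left₀ (polytopeDist_nonneg a x) ?_ 2
    refine (polytopeDist_le hk (convex_convexHull ℝ _) (fun x hx y hy =>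
      Metric.dist_le_diam_of_mem (isBounded_convexHull.2 hμ) hx hy) ha hx).trans ?_
    simp [D]
  set M : ℕ := 2 * p + 3
  -- The fluctuation `τ` is chosen such that `n τ² / (4 D²) = M log n`.
  refine ⟨2 * (2 * D * Real.sqrt M) + 2 * c + C, by positivity, max N 3, ?_⟩
  intro Ω _ P _ X A hX hA n hn
  have hn3 : 3 ≤ n := (le_max_right _ _).trans hn.le
  have hn0 : (0 : ℝ) < n := by positivity
  have ht : 0 < Real.log n / n := log_div_pos hn3
  set τ : ℝ := 2 * D * Real.sqrt M * Real.sqrt (Real.log n / n) with hτdef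
  have hτ : 0 < τ := by positivity
  have hτM : (n : ℝ) * (τ ^ 2 / (4 * D ^ 2)) = M * Real.log n := by
    rw [hτdef, mul_pow, mul_pow, mul_pow, Real.sq_sqrt (Nat.cast_nonneg M), Real.sq_sqrt ht.le]
    field_simp
    ring
  obtain ⟨T, hTmem, hTcard, hT⟩ := hnet n (by omega)
  let bad : (Fin k → Euc d) → Set Ω := fun a =>
    {ω | ¬ (archObjective μ a ≤ dataObjective (fun i => X i ω) n a + τ ∧
        dataObjective (fun i => X i ω) n a ≤ archObjective μ a + τ)}
  have hbad : ∀ a : Fin k → Euc d, (∀ l, a l ∈ convexHull ℝ μ.support) →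
      P (bad a) ≤ ENNReal.ofReal (2 * Real.exp (-(M * Real.log n))) := by
    intro a ha
    have := hX.measure_objective_deviation_le a (by positivity : 0 < D ^ 2) (hB a ha) hτ
      (by omega : 1 ≤ n)
    rwa [hτM] at this
  have h1 := measure_biUnion_net_le P (by omega : 2 ≤ n) T hTcard bad
    fun t htT => hbad t (hTmem t htT)
  have h2 := measure_biUnion_net_le P (p := p) (by omega : 2 ≤ n) {Astar}
    (by rw [Finset.card_singleton]; exact Nat.one_le_pow _ _ (by omega)) bad
    (fun t htT => by rw [Finset.mem_singleton.1 htT]; exact hbad Astar hstar.1)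
  have h3 := hhull Ω P X hX n ((le_max_left _ _).trans_lt hn)
  have hunion := (measure_union_le _ _).trans
    (add_le_add ((measure_union_le _ _).trans (add_le_add h1 h2)) h3)
  refine le_trans (measure_mono_ae ?_) (hunion.trans ?_)
  · filter_upwards [hX.ae_mem_support] with ω hω hfail
    have hfail' : ¬ (archObjective μ (A n ω) - archObjective μ Astar
        ≤ (2 * (2 * D * Real.sqrt M) + 2 * c + C) * (Real.log n / n) ^ (1 / α)) := hfail
    by_contra hnot
    apply hfail'
    have hgood1 : ∀ t ∈ T, archObjective μ t ≤ dataObjective (fun i => X i ω) n t + τ := by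
      intro t htT
      by_contra hcon
      exact hnot (Or.inl (Or.inl (Set.mem_iUnion₂.2 ⟨t, htT, fun h => hcon h.1⟩)))
    have hgood2 : dataObjective (fun i => X i ω) n Astar ≤ archObjective μ Astar + τ := by
      by_contra hcon
      exact hnot (Or.inl (Or.inr (Set.mem_iUnion₂.2
        ⟨Astar, Finset.mem_singleton_self _, fun h => hcon h.2⟩)))
    have hgood3 : ∀ a ∈ convexHull ℝ μ.support,
          ∃ b ∈ convexHull ℝ ((fun i => X i ω) '' Set.Iio n),
            dist a b ≤ C * (Real.log n / n) ^ (1 / α) := by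
      by_contra hcon
      exact hnot (Or.inr hcon)
    have hmain := archObjective_le_of_net hk hμ hω (by omega : 1 ≤ n) (hA n (by omega) ω)
      (by positivity) hT hgood1 hgood2 fun l => hgood3 _ (hstar.1 l)
    have hsqrt : Real.sqrt (Real.log n / n) ≤ (Real.log n / n) ^ (1 / α) := by
      rw [Real.sqrt_eq_rpow]
      exact log_div_rpow_le hn3 (one_div_le_one_div_of_le (by norm_num) hα)
    have e1 : τ ≤ 2 * D * Real.sqrt M * (Real.log n / n) ^ (1 / α) :=
      mul_le_mul_of_nonneg_left hsqrt (by positivity)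
    have e2 : c / n ≤ c * (Real.log n / n) ^ (1 / α) := by
      rw [div_eq_mul_one_div]
      exact mul_le_mul_of_nonneg_left (inv_le_rpow hn3 hα1) hc.le
    linarith
  · rw [← ENNReal.ofReal_add (by positivity) (by positivity),
      ← ENNReal.ofReal_add (by positivity) (by positivity)]
    refine ENNReal.ofReal_le_ofReal ?_
    rw [← add_div, ← add_div]
    gcongr
    norm_num

/-! ### The line -/

lemma euc_one_dist (x y : Euc 1) : dist x y = |x 0 - y 0| := by
  rw [EuclideanSpace.dist_eq, Fin.sum_univ_one, Real.dist_eq, sq_abs, Real.sqrt_sq_eq_abs]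

lemma euc_one_ext {x y : Euc 1} (h : x 0 = y 0) : x = y := by
  ext i; rwa [Subsingleton.elim i 0]

lemma mem_segment_euc_one {p q x : Euc 1} (hp : p 0 ≤ x 0) (hq : x 0 ≤ q 0) :
    x ∈ segment ℝ p q := by
  have hx : x 0 ∈ segment ℝ (p 0) (q 0) := by
    rw [segment_eq_Icc (hp.trans hq)]; exact ⟨hp, hq⟩
  obtain ⟨s, t, hs, ht, hst, h⟩ := hx
  exact ⟨s, t, hs, ht, hst, euc_one_ext (by simpa using h)⟩

/-- On the line two archetypes suffice to fit the data exactly, so the hull of any archetype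
pointset of `k ≥ 2` points contains the data. -/
lemma convexHull_data_subset_of_isDataArchetype {k : ℕ} (hk : 2 ≤ k) {x : ℕ → Euc 1} {n : ℕ}
    (hn : 1 ≤ n) {A : Fin k → Euc 1} (hA : IsDataArchetype x n A) :
    convexHull ℝ (x '' Set.Iio n) ⊆ convexHull ℝ (Set.range A) := by
  have hne : (Finset.range n).Nonempty := ⟨0, Finset.mem_range.2 hn⟩
  obtain ⟨i, hi, hmin⟩ := Finset.exists_min_image (Finset.range n) (fun i => x i 0) hne
  obtain ⟨j, hj, hmax⟩ := Finset.exists_max_image (Finset.range n) (fun i => x i 0) hne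
  let b : Fin k → Euc 1 := fun l => if l.1 = 0 then x i else x j
  have hbi : x i ∈ convexHull ℝ (Set.range b) := subset_convexHull ℝ _ ⟨⟨0, by omega⟩, by simp [b]⟩
  have hbj : x j ∈ convexHull ℝ (Set.range b) := subset_convexHull ℝ _ ⟨⟨1, by omega⟩, by simp [b]⟩
  have hb : ∀ l, b l ∈ convexHull ℝ (x '' Set.Iio n) := by
    intro l
    refine subset_convexHull ℝ _ ?_
    by_cases hl : l.1 = 0
    · exact ⟨i, Finset.mem_range.1 hi, by simp [b, hl]⟩
    · exact ⟨j, Finset.mem_range.1 hj, by simp [b, hl]⟩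
  have hb0 : dataObjective x n b = 0 := by
    rw [dataObjective, Finset.sum_eq_zero, mul_zero, Real.sqrt_zero]
    intro m hm
    have : x m ∈ convexHull ℝ (Set.range b) :=
      (convex_convexHull ℝ _).segment_subset hbi hbj (mem_segment_euc_one (hmin m hm) (hmax m hm))
    rw [polytopeDist, Metric.infDist_zero_of_mem this, zero_pow two_ne_zero]
  have hA0 : dataObjective x n A = 0 :=
    le_antisymm ((hA.2 b hb).trans_eq hb0) (dataObjective_nonneg x n A)
  have hsum : ∑ m ∈ Finset.range n, polytopeDist A (x m) ^ 2 = 0 := by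
    have hn0 : (n : ℝ) ≠ 0 := by positivity
    have h2 := dataObjective_sq x n A
    rw [hA0, zero_pow two_ne_zero] at h2
    simpa [hn0] using h2.symm
  refine convexHull_min ?_ (convex_convexHull ℝ _)
  rintro _ ⟨m, hm, rfl⟩
  have h0 := (Finset.sum_eq_zero_iff_of_nonneg fun _ _ => sq_nonneg _).1 hsum m
    (Finset.mem_range.2 hm)
  exact ((Set.finite_range A).isClosed_convexHull ℝ).mem_iff_infDist_zero
    (convexHull_range_nonempty (by omega) A) |>.2 (pow_eq_zero_iff two_ne_zero |>.1 h0)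

/-- The rate on the line for at least two archetypes: the error is bounded by the Hausdorff
distance between the hulls of the data and of the support. -/
lemma exists_hasArchetypeRate_line {k : ℕ} (hk : 2 ≤ k) {μ : Measure (Euc 1)}
    [IsProbabilityMeasure μ] (Astar : Fin k → Euc 1) {α L η : ℝ}
    (hα : 1 ≤ α) (hcap : CapCondition μ α L η) :
    ∃ C, 0 < C ∧ HasArchetypeRate.{u} μ Astar α C := by
  obtain ⟨C, N, hC, hhull⟩ := exists_hull_rate.{u} hα hcap
  refine ⟨C, hC, max N 3, ?_⟩
  intro Ω _ P _ X A hX hA n hn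
  have hn3 : 3 ≤ n := (le_max_right _ _).trans hn.le
  refine (measure_mono fun ω hω => ?_).trans ((hhull Ω P X hX n ((le_max_left _ _).trans_lt hn)).trans
    (ENNReal.ofReal_le_ofReal (by gcongr; norm_num)))
  simp only [Set.mem_ofPred_eq] at hω ⊢
  contrapose! hω
  set ε : ℝ := C * (Real.log n / n) ^ (1 / α)
  have hε : 0 ≤ ε := mul_nonneg hC.le (Real.rpow_nonneg (log_div_nonneg n) _)
  have hsub := convexHull_data_subset_of_isDataArchetype hk (by omega) (hA n (by omega) ω)
  have hdist : ∀ᵐ x ∂μ, polytopeDist (A n ω) x ^ 2 ≤ ε ^ 2 := by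
    filter_upwards [ae_mem_convexHull_support μ] with x hx
    obtain ⟨b, hb, hxb⟩ := hω x hx
    exact pow_le_pow_left₀ (polytopeDist_nonneg _ x)
      ((Metric.infDist_le_dist_of_mem (hsub hb)).trans hxb) 2
  have hF : archObjective μ (A n ω) ≤ ε := by
    refine Real.sqrt_le_iff.2 ⟨hε, ?_⟩
    refine (integral_mono_ae (integrable_polytopeDist_sq (by omega) hcap.bounded _)
      (integrable_const _) hdist).trans ?_
    simp
  linarith [archObjective_nonneg μ Astar]

lemma polytopeDist_sq_euc_one (a : Fin 1 → Euc 1) (x : Euc 1) :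
    polytopeDist a x ^ 2 = (x 0 - a 0 0) ^ 2 := by
  rw [polytopeDist, Set.range_unique, convexHull_singleton, Metric.infDist_singleton,
    euc_one_dist, sq_abs]
  rfl

/-- Hoeffding's inequality for the mean of a bounded function of the samples. -/
lemma IsIIDSample.measure_mean_deviation_le {d : ℕ} {μ : Measure (Euc d)} {Ω : Type*}
    [MeasurableSpace Ω] {P : Measure Ω} [IsProbabilityMeasure P] {X : ℕ → Ω → Euc d}
    (h : IsIIDSample μ P X) {f : Euc d → ℝ} (hf : Continuous f) {R : ℝ} (hR : 0 < R)
    (hfR : ∀ᵐ x ∂μ, |f x| ≤ R) {τ : ℝ} (hτ : 0 < τ) {n : ℕ} (hn : 1 ≤ n) :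
    P {ω | τ < |(1 / (n : ℝ)) * (∑ i ∈ Finset.range n, f (X i ω)) - ∫ x, f x ∂μ|} ≤
      ENNReal.ofReal (2 * Real.exp (-(n * (τ ^ 2 / (2 * R ^ 2))))) := by
  have hn0 : (0 : ℝ) < n := by exact_mod_cast hn
  have tail : ∀ g : Euc d → ℝ, Continuous g → (∀ᵐ x ∂μ, |g x| ≤ R) →
      P {ω | n * τ ≤ ∑ i ∈ Finset.range n, (g (X i ω) - ∫ x, g x ∂μ)} ≤
        ENNReal.ofReal (Real.exp (-(n * (τ ^ 2 / (2 * R ^ 2))))) := by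
    intro g hg hgR
    have hind : iIndepFun (fun i ω => g (X i ω) - ∫ x, g x ∂μ) P :=
      h.indep.comp (fun _ x => g x - ∫ x, g x ∂μ) fun _ => (hg.sub continuous_const).measurable
    have hsub : ∀ i < n, HasSubgaussianMGF (fun ω => g (X i ω) - ∫ x, g x ∂μ)
        ((‖R - -R‖₊ / 2) ^ 2) P := by
      intro i _
      have := hasSubgaussianMGF_of_mem_Icc (a := -R) (b := R) (X := fun ω => g (X i ω)) (μ := P)
        (hg.measurable.comp_aemeasurable (h.law i).aemeasurable) (by
          filter_upwards [h.ae_of_ae hgR] with ω hω using abs_le.1 (hω i))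
      rwa [h.integral_comp hg i] at this
    have := HasSubgaussianMGF.measure_sum_range_ge_le_of_iIndepFun hind hsub
      (ε := n * τ) (by positivity)
    rw [← ofReal_measureReal]
    refine ENNReal.ofReal_le_ofReal (this.trans_eq ?_)
    congr 1
    have e : (((‖R - -R‖₊ / 2) ^ 2 : NNReal) : ℝ) = R ^ 2 := by
      push_cast
      rw [sub_neg_eq_add, Real.norm_of_nonneg (by positivity)]
      ring
    rw [e]
    field_simp
  have h1 := tail f hf hfR
  have h2 := tail (fun x => -f x) hf.neg (by simpa using hfR)
  refine le_trans (measure_mono fun ω hω => ?_) ((measure_union_le _ _).trans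
    ((add_le_add h1 h2).trans_eq (by
      rw [← ENNReal.ofReal_add (Real.exp_pos _).le (Real.exp_pos _).le, ← two_mul])))
  simp only [Set.mem_ofPred_eq, Set.mem_union, Finset.sum_sub_distrib, Finset.sum_const,
    Finset.card_range, nsmul_eq_mul, Finset.sum_neg_distrib, integral_neg] at hω ⊢
  have e : ∑ i ∈ Finset.range n, f (X i ω)
      = n * ((1 / (n : ℝ)) * ∑ i ∈ Finset.range n, f (X i ω)) := by field_simp
  rcases lt_abs.1 hω with hω | hω
  · left
    rw [e]
    nlinarith
  · right
    rw [e]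
    nlinarith

/-- The rate on the line for a single archetype.  The optimal archetypes are the means, and the
squared objective exceeds its minimum by the square of the distance to the mean, so that the
error is quadratic in the fluctuation `√(log n / n)` of the empirical mean. -/
lemma exists_hasArchetypeRate_line_single {μ : Measure (Euc 1)} [IsProbabilityMeasure μ]
    (hμ : Bornology.IsBounded μ.support) (Astar : Fin 1 → Euc 1) {α : ℝ} (hα : 1 ≤ α) :
    ∃ C, 0 < C ∧ HasArchetypeRate.{u} μ Astar α C := by
  obtain ⟨R, hR, hsR⟩ := hμ.subset_closedBall_lt 0 (0 : Euc 1)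
  have hcont : Continuous fun x : Euc 1 => x 0 := by fun_prop
  have habs : ∀ᵐ x : Euc 1 ∂μ, |x 0| ≤ R := by
    filter_upwards [Measure.support_mem_ae (μ := μ)] with x hx
    have := hsR hx
    rw [Metric.mem_closedBall, euc_one_dist] at this
    simpa using this
  set m : ℝ := ∫ x : Euc 1, x 0 ∂μ
  set v : ℝ := ∫ x : Euc 1, (x 0 - m) ^ 2 ∂μ with hv
  have hv0 : 0 ≤ v := integral_nonneg fun _ => sq_nonneg _
  have hlin : Integrable (fun x : Euc 1 => x 0 - m) μ :=
    Integrable.of_bound (C := R + |m|) (by fun_prop) (by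
      filter_upwards [habs] with x hx
      exact (norm_sub_le _ _).trans (add_le_add hx le_rfl))
  have hquad : Integrable (fun x : Euc 1 => (x 0 - m) ^ 2) μ := by
    have h := integrable_polytopeDist_sq le_rfl hμ
      (fun _ : Fin 1 => (WithLp.toLp 2 fun _ => m : Euc 1))
    simpa only [polytopeDist_sq_euc_one] using h
  have hlin0 : ∫ x : Euc 1, (x 0 - m) ∂μ = 0 := by
    have hx : Integrable (fun x : Euc 1 => x 0) μ := by
      have := hlin.add (integrable_const m)
      exact this.congr (ae_of_all _ fun x => by simp)
    rw [integral_sub hx (integrable_const _)]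
    simp [m]
  have hG : ∀ a : Fin 1 → Euc 1, archObjective μ a ^ 2 = v + (a 0 0 - m) ^ 2 := by
    intro a
    have e : ∀ x : Euc 1, polytopeDist a x ^ 2
        = ((x 0 - m) ^ 2 + 2 * (m - a 0 0) * (x 0 - m)) + (a 0 0 - m) ^ 2 := by
      intro x; rw [polytopeDist_sq_euc_one]; ring
    have h12 : Integrable (fun x : Euc 1 => (x 0 - m) ^ 2 + 2 * (m - a 0 0) * (x 0 - m)) μ :=
      hquad.add (hlin.const_mul _)
    rw [archObjective_sq]
    simp only [e]
    rw [integral_add h12 (integrable_const _), integral_add hquad (hlin.const_mul _),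
      integral_const_mul, hlin0]
    simp [hv]
  have hmean : ∀ (x : ℕ → Euc 1) (n : ℕ), 1 ≤ n → ∀ A : Fin 1 → Euc 1, IsDataArchetype x n A →
      A 0 0 = (1 / (n : ℝ)) * ∑ i ∈ Finset.range n, x i 0 := by
    intro x n hn A hA
    have hn0 : (n : ℝ) ≠ 0 := by positivity
    set M : ℝ := (1 / (n : ℝ)) * ∑ i ∈ Finset.range n, x i 0 with hM
    have hMn : ∑ i ∈ Finset.range n, x i 0 = n * M := by rw [hM]; field_simp
    have hdata : ∀ a : Fin 1 → Euc 1, dataObjective x n a ^ 2 =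
        (1 / (n : ℝ)) * (∑ i ∈ Finset.range n, (x i 0 - M) ^ 2) + (a 0 0 - M) ^ 2 := by
      intro a
      have e : ∀ i, polytopeDist a (x i) ^ 2
          = ((x i 0 - M) ^ 2 + 2 * (M - a 0 0) * (x i 0 - M)) + (a 0 0 - M) ^ 2 := by
        intro i; rw [polytopeDist_sq_euc_one]; ring
      rw [dataObjective_sq]
      simp only [e, Finset.sum_add_distrib, ← Finset.mul_sum, Finset.sum_sub_distrib, hMn,
        Finset.sum_const, Finset.card_range, nsmul_eq_mul, sub_self, mul_zero, add_zero]
      field_simp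
    have hb : ∑ i ∈ Finset.range n, (1 / (n : ℝ)) • x i ∈ convexHull ℝ (x '' Set.Iio n) := by
      refine (convex_convexHull ℝ _).sum_mem (fun _ _ => by positivity) ?_ fun i hi =>
        subset_convexHull ℝ _ ⟨i, Finset.mem_range.1 hi, rfl⟩
      simp [hn0]
    have hb0 : (∑ i ∈ Finset.range n, (1 / (n : ℝ)) • x i) 0 = M := by
      rw [hM, Finset.mul_sum]
      simp
    have hle := pow_le_pow_left₀ (dataObjective_nonneg x n A)
      (hA.2 (fun _ => ∑ i ∈ Finset.range n, (1 / (n : ℝ)) • x i) fun _ => hb) 2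
    rw [hdata, hdata, hb0, sub_self] at hle
    have hzero : (A 0 0 - M) ^ 2 = 0 := le_antisymm (by linarith) (sq_nonneg _)
    linarith [pow_eq_zero_iff two_ne_zero |>.1 hzero]
  rcases hv0.eq_or_lt with hv0 | hvpos
  · -- A vanishing variance: all samples coincide with the mean.
    have hconst : ∀ᵐ x : Euc 1 ∂μ, x 0 = m := by
      have := (integral_eq_zero_iff_of_nonneg (fun _ => sq_nonneg _) hquad).1 hv0.symm
      filter_upwards [this] with x hx
      exact sub_eq_zero.1 (pow_eq_zero_iff two_ne_zero |>.1 hx)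
    refine ⟨1, one_pos, 0, ?_⟩
    intro Ω _ P _ X A hX hA n hn
    have hnull : P {ω | ¬ (archObjective μ (A n ω) - archObjective μ Astar
        ≤ 1 * (Real.log n / n) ^ (1 / α))} = 0 := by
      refine ae_iff.1 ?_
      filter_upwards [hX.ae_of_ae hconst] with ω hω
      have hAm : A n ω 0 0 = m := by
        rw [hmean _ n hn _ (hA n hn ω)]
        have : (n : ℝ) ≠ 0 := by positivity
        simp [hω, this]
      have h0 := hG (A n ω)
      rw [← hv0, hAm, sub_self, zero_pow two_ne_zero, add_zero] at h0
      have hz := pow_eq_zero_iff two_ne_zero |>.1 h0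
      have := archObjective_nonneg μ Astar
      have := Real.rpow_nonneg (log_div_nonneg n) (1 / α)
      linarith
    rw [hnull]
    exact zero_le
  · refine ⟨6 * R ^ 2 / Real.sqrt v, by positivity, 3, ?_⟩
    intro Ω _ P _ X A hX hA n hn
    have hn3 : 3 ≤ n := hn.le
    have hn0 : (0 : ℝ) < n := by positivity
    have ht : 0 < Real.log n / n := log_div_pos hn3
    set τ : ℝ := Real.sqrt (6 * R ^ 2 * (Real.log n / n)) with hτ
    have hτ2 : τ ^ 2 = 6 * R ^ 2 * (Real.log n / n) := Real.sq_sqrt (by positivity)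
    have hdev := hX.measure_mean_deviation_le hcont hR habs (τ := τ) (by positivity)
      (by omega : 1 ≤ n)
    have e : (n : ℝ) * (τ ^ 2 / (2 * R ^ 2)) = (2 * 0 + 3 : ℕ) * Real.log n := by
      rw [hτ2]; push_cast; field_simp; ring
    rw [e] at hdev
    have hone := measure_biUnion_net_le P (p := 0) (by omega : 2 ≤ n) {()} (by simp)
      (fun _ => {ω | τ < |(1 / (n : ℝ)) * (∑ i ∈ Finset.range n, X i ω 0) - m|})
      (fun _ _ => hdev)
    simp only [Finset.mem_singleton, Set.iUnion_const] at hone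
    refine (measure_mono fun ω hω => ?_).trans (hone.trans
      (ENNReal.ofReal_le_ofReal (by gcongr; norm_num)))
    simp only [Set.mem_ofPred_eq] at hω ⊢
    by_contra hnot
    apply hω
    rw [not_lt, ← hmean _ n (by omega) _ (hA n (by omega) ω)] at hnot
    have hsq : (A n ω 0 0 - m) ^ 2 ≤ τ ^ 2 := sq_le_sq' (abs_le.1 hnot).1 (abs_le.1 hnot).2
    have hFA := hG (A n ω)
    have hFs := hG Astar
    set FA := archObjective μ (A n ω)
    set Fs := archObjective μ Astar
    have hFA0 : 0 ≤ FA := archObjective_nonneg _ _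
    have hsqrtv : 0 < Real.sqrt v := Real.sqrt_pos.2 hvpos
    have hvs : Real.sqrt v ≤ Fs :=
      Real.sqrt_le_iff.2 ⟨archObjective_nonneg _ _, by nlinarith [sq_nonneg (Astar 0 0 - m)]⟩
    have hlow : FA - Fs ≤ τ ^ 2 / Real.sqrt v := by
      rw [le_div_iff₀ hsqrtv]
      rcases le_or_gt FA Fs with hle | hlt
      · nlinarith [sq_nonneg τ]
      · have h1 : (FA - Fs) * (FA + Fs) ≤ τ ^ 2 := by nlinarith [sq_nonneg (Astar 0 0 - m)]
        have h2 : (FA - Fs) * Real.sqrt v ≤ (FA - Fs) * (FA + Fs) :=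
          mul_le_mul_of_nonneg_left (by linarith) (by linarith)
        linarith
    refine hlow.trans ?_
    rw [hτ2, mul_div_right_comm]
    exact mul_le_mul_of_nonneg_left (log_div_le_rpow hn3 hα) (by positivity)

/-! ### A constant independent of the cap parameters -/

/-- The rate, with a constant that may depend on the parameters of the cap condition. -/
lemma exists_hasArchetypeRate {d k : ℕ} (hk : 1 ≤ k) {μ : Measure (Euc d)}
    [IsProbabilityMeasure μ] {Astar : Fin k → Euc d} (hstar : IsArchetype μ Astar) {α L η : ℝ}
    (hα : min (d : ℝ) 2 ≤ α) (hcap : CapCondition μ α L η) :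
    ∃ C, 0 < C ∧ HasArchetypeRate.{u} μ Astar α C := by
  rcases Nat.lt_or_ge d 2 with hd | hd
  · interval_cases d
    · refine ⟨1, one_pos, 0, ?_⟩
      intro Ω _ P _ X A _ _ n _
      have hempty : {ω | ¬ (archObjective μ (A n ω) - archObjective μ Astar
          ≤ 1 * (Real.log n / n) ^ (1 / α))} = ∅ := by
        ext ω
        have := Real.rpow_nonneg (log_div_nonneg n) (1 / α)
        simp only [Set.mem_ofPred_eq, Set.mem_empty_iff_false, iff_false, not_not]
        rw [Subsingleton.elim (A n ω) Astar]
        linarith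
      rw [hempty, measure_empty]
      exact zero_le
    · have hα1 : 1 ≤ α := by simpa using hα
      rcases hk.eq_or_lt with rfl | hk2
      · exact exists_hasArchetypeRate_line_single hcap.bounded Astar hα1
      · exact exists_hasArchetypeRate_line hk2 Astar hα1 hcap
  · have hd' : (2 : ℝ) ≤ d := by exact_mod_cast hd
    rw [min_eq_right hd'] at hα
    exact exists_hasArchetypeRate_of_two_le hk hstar hα hcap

/-- A rate with a smaller exponent holds with constant `1`. -/
lemma HasArchetypeRate.of_lt {d k : ℕ} {μ : Measure (Euc d)} {Astar : Fin k → Euc d}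
    {α β C C' : ℝ} (h : HasArchetypeRate.{u} μ Astar α C) (hα : 0 < α) (hαβ : α < β)
    (hC' : 1 ≤ C') :
    HasArchetypeRate.{u} μ Astar β C' := by
  obtain ⟨N, hN⟩ := h
  have hβ : 0 < β := hα.trans hαβ
  have hgap : 0 < 1 / α - 1 / β := sub_pos.2 (one_div_lt_one_div_of_lt hα hαβ)
  have hsmall : ∀ᶠ n : ℕ in atTop, C * (Real.log n / n) ^ (1 / α - 1 / β) < 1 := by
    have := (tendsto_log_div_rpow hgap).const_mul C
    rw [mul_zero] at this
    exact this.eventually (gt_mem_nhds one_pos)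
  obtain ⟨N', hN'⟩ := eventually_atTop.1 hsmall
  refine ⟨max N (max N' 3), ?_⟩
  intro Ω _ P _ X A hX hA n hn
  have hn1 : N < n := (le_max_left _ _).trans_lt hn
  have hn2 : N' ≤ n := ((le_max_left _ _).trans (le_max_right _ _)).trans hn.le
  have hn3 : 3 ≤ n := ((le_max_right _ _).trans (le_max_right _ _)).trans hn.le
  refine (measure_mono fun ω hω => ?_).trans (hN Ω P X A hX hA n hn1)
  simp only [Set.mem_ofPred_eq] at hω ⊢
  refine fun hle => hω (hle.trans ?_)
  have ht := log_div_pos hn3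
  have e : (Real.log n / n) ^ (1 / α)
      = (Real.log n / n) ^ (1 / α - 1 / β) * (Real.log n / n) ^ (1 / β) := by
    rw [← Real.rpow_add ht, sub_add_cancel]
  rw [e, ← mul_assoc]
  exact mul_le_mul_of_nonneg_right ((hN' n hn2).le.trans hC') (Real.rpow_nonneg ht.le _)

/-- One constant serves all parameters of the cap condition.  If `α` exceeds another admissible
exponent then the constant is irrelevant, as the rate of that exponent is of smaller order; the
only exponent for which the constant matters is thus the smallest admissible one, if it exists. -/
lemma exists_uniform_hasArchetypeRate {d k : ℕ} (hk : 1 ≤ k) {μ : Measure (Euc d)}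
    [IsProbabilityMeasure μ] {Astar : Fin k → Euc d} (hstar : IsArchetype μ Astar) :
    ∃ C, 0 < C ∧ ∀ α : ℝ, min (d : ℝ) 2 ≤ α → (∃ L η, CapCondition μ α L η) →
      HasArchetypeRate.{u} μ Astar α C := by
  by_cases hleast : ∃ α₀, IsLeast {α : ℝ | min (d : ℝ) 2 ≤ α ∧ ∃ L η, CapCondition μ α L η} α₀
  · obtain ⟨α₀, ⟨hα₀, L, η, hcap⟩, hmin⟩ := hleast
    obtain ⟨C, hC, hrate⟩ := exists_hasArchetypeRate.{u} hk hstar hα₀ hcap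
    refine ⟨max C 1, by positivity, fun α hα hex => ?_⟩
    rcases (hmin ⟨hα, hex⟩).eq_or_lt with rfl | hlt
    · obtain ⟨N, hN⟩ := hrate
      refine ⟨N, fun Ω _ P _ X A hX hA n hn =>
        (measure_mono fun ω hω => ?_).trans (hN Ω P X A hX hA n hn)⟩
      simp only [Set.mem_ofPred_eq] at hω ⊢
      exact fun hle => hω (hle.trans (mul_le_mul_of_nonneg_right (le_max_left _ _)
        (Real.rpow_nonneg (log_div_nonneg n) _)))
    · exact hrate.of_lt hcap.alpha_pos hlt (le_max_right _ _)
  · refine ⟨1, one_pos, fun α hα hex => ?_⟩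
    have hnot : ¬ α ∈ lowerBounds
        {α : ℝ | min (d : ℝ) 2 ≤ α ∧ ∃ L η, CapCondition μ α L η} :=
      fun h => hleast ⟨α, ⟨hα, hex⟩, h⟩
    simp only [lowerBounds, Set.mem_ofPred_eq, not_forall, not_le] at hnot
    obtain ⟨β, ⟨hβ, L, η, hcap⟩, hlt⟩ := hnot
    obtain ⟨C, -, hrate⟩ := exists_hasArchetypeRate.{u} hk hstar hβ hcap
    exact hrate.of_lt hcap.alpha_pos hlt le_rfl

/-! ### Densities bounded from below on a convex set -/

lemma nonempty_interior_of_measure_ne_zero {d : ℕ} {K : Set (Euc d)} (hK : Convex ℝ K)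
    (h : volume K ≠ 0) : (interior K).Nonempty := by
  by_contra hempty
  rw [Set.not_nonempty_iff_eq_empty] at hempty
  refine h (measure_mono_null ?_ (hK.addHaar_frontier volume))
  rw [frontier, hempty, Set.sdiff_empty]
  exact subset_closure

/-- If `μ` has a density bounded from below on a convex set, then it satisfies the cap condition
with exponent the dimension: a cap of depth `ε` contains a copy of a fixed ball of the convex set,
shrunk by a factor of order `ε` towards a nearly extremal point. -/
lemma HasLowerBoundedDensityOnConvex.exists_capCondition {d : ℕ} (hd : 1 ≤ d)
    {μ : Measure (Euc d)} [IsProbabilityMeasure μ] (hμ : Bornology.IsBounded μ.support)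
    (h : HasLowerBoundedDensityOnConvex μ) : ∃ L η, CapCondition μ d L η := by
  obtain ⟨K, f, c, hK, hf, hc, hfc, hμK⟩ := h
  have hvol : volume K ≠ 0 := by
    intro h0
    have hzero : μ = 0 := by
      rw [hμK, Measure.restrict_eq_zero.2 h0, withDensity_zero_left]
    exact IsProbabilityMeasure.ne_zero μ hzero
  have hlower : ∀ B : Set (Euc d), MeasurableSet B → B ⊆ K →
      ENNReal.ofReal c * volume B ≤ μ B := by
    intro B hB hBK
    rw [hμK, withDensity_apply f hB, Measure.restrict_restrict hB,
      Set.inter_eq_self_of_subset_left hBK, ← setLIntegral_const]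
    exact setLIntegral_mono' hB fun x hx => hfc x (hBK hx)
  obtain ⟨p, hp⟩ := nonempty_interior_of_measure_ne_zero hK hvol
  obtain ⟨r, hr, hball⟩ := Metric.mem_nhds_iff.1 (mem_interior_iff_mem_nhds.1 hp)
  have hsupp : convexHull ℝ μ.support ⊆ closure K := by
    refine convexHull_min (Measure.support_subset_of_isClosed isClosed_closure ?_) hK.closure
    have hac : μ ≪ volume.restrict K := by
      rw [hμK]; exact withDensity_absolutelyContinuous _ _
    refine hac.ae_le (mem_ae_iff.2 ?_)
    rw [Measure.restrict_apply isClosed_closure.measurableSet.compl]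
    refine measure_mono_null (fun x hx => ?_) measure_empty
    exact absurd (subset_closure hx.2) hx.1
  have hne : (convexHull ℝ μ.support).Nonempty := by
    obtain ⟨x, hx⟩ := (ae_mem_convexHull_support μ).exists
    exact ⟨x, hx⟩
  obtain ⟨R, hR, hKR⟩ := ((isBounded_convexHull.2 hμ).union
    (Bornology.isBounded_singleton (x := p))).subset_closedBall_lt 0 (0 : Euc d)
  have hnorm : ∀ x ∈ convexHull ℝ μ.support, ‖x‖ ≤ R := fun x hx => by
    simpa using hKR (Or.inl hx)
  have hpR : ‖p‖ ≤ R := by simpa using hKR (Or.inr rfl)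
  set D : ℝ := 2 * R + 1 + r
  have hD : 0 < D := by positivity
  set w : ℝ := volume.real (Metric.ball (0 : Euc d) 1)
  have hw : 0 < w := ENNReal.toReal_pos (Metric.measure_ball_pos volume _ one_pos).ne'
    measure_ball_lt_top.ne
  refine ⟨c * (r / (2 * D)) ^ d * w, 1, ⟨by exact_mod_cast hd, by positivity, one_pos, hμ, ?_⟩⟩
  rintro ε ⟨hε, hε1⟩ u hu
  set t : ℝ := ε / (2 * D) with ht
  have ht0 : 0 < t := by positivity
  have htD : t * D = ε / 2 := by rw [ht]; field_simp
  have ht1 : t ≤ 1 := by nlinarith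
  -- A point `z` of `K` within `ε / 2` of extremal in the direction `u`.
  obtain ⟨_, ⟨y, hy, rfl⟩, hyu⟩ := exists_lt_of_lt_csSup (hne.image fun z => inner ℝ z u)
    (show sSup ((fun z => inner ℝ z u) '' convexHull ℝ μ.support) - ε / 4 < _ by linarith)
  obtain ⟨z, hz, hyz⟩ := Metric.mem_closure_iff.1 (hsupp hy) (ε / 4) (by positivity)
  have hyz' : inner ℝ y u - inner ℝ z u ≤ ε / 4 := by
    rw [← inner_sub_left]
    refine (real_inner_le_norm _ _).trans ?_
    rw [hu, mul_one, ← dist_eq_norm]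
    exact hyz.le
  have hzR : ‖z‖ ≤ R + 1 := by
    have h1 : ‖z - y‖ ≤ ε / 4 := by rw [← dist_eq_norm, dist_comm]; exact hyz.le
    have h2 := norm_le_norm_add_norm_sub' z y
    linarith [hnorm y hy]
  set B : Set (Euc d) := Metric.ball (z + t • (p - z)) (t * r)
  have hBrep : ∀ x ∈ B, ∃ q ∈ Metric.ball p r, x = z + t • (q - z) := by
    intro x hx
    refine ⟨z + t⁻¹ • (x - z), ?_, ?_⟩
    · rw [Metric.mem_ball, dist_eq_norm] at hx ⊢
      have e : z + t⁻¹ • (x - z) - p = t⁻¹ • (x - (z + t • (p - z))) := by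
        rw [← sub_sub, smul_sub t⁻¹ (x - z), inv_smul_smul₀ ht0.ne']
        abel
      rw [e, norm_smul, norm_inv, Real.norm_of_nonneg ht0.le, inv_mul_lt_iff₀ ht0]
      exact hx
    · rw [add_sub_cancel_left, smul_inv_smul₀ ht0.ne', add_sub_cancel]
  have hBK : B ⊆ K := by
    intro x hx
    obtain ⟨q, hq, rfl⟩ := hBrep x hx
    exact hK.add_smul_sub_mem hz (hball hq) ⟨ht0.le, ht1⟩
  have hBcap : ∀ x ∈ B,
      sSup ((fun z => inner ℝ z u) '' convexHull ℝ μ.support) - ε ≤ inner ℝ x u := by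
    intro x hx
    obtain ⟨q, hq, rfl⟩ := hBrep x hx
    have hqz : ‖q - z‖ ≤ D := by
      have h1 : ‖q - p‖ < r := by rwa [Metric.mem_ball, dist_eq_norm] at hq
      have h2 := norm_le_norm_add_norm_sub' q p
      have h3 := norm_sub_le q z
      linarith
    have habs : |inner ℝ (q - z) u| ≤ D :=
      (abs_real_inner_le_norm _ _).trans (by rw [hu, mul_one]; exact hqz)
    have hin := (abs_le.1 habs).1
    have := mul_le_mul_of_nonneg_left hin ht0.le
    rw [inner_add_left, real_inner_smul_left]
    nlinarith
  have hmono : μ B ≤ μ (cap μ u ε) := by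
    refine measure_mono_ae ?_
    filter_upwards [ae_mem_convexHull_support μ] with x hx hxB using ⟨hx, hBcap x hxB⟩
  have hle := (hlower B measurableSet_ball hBK).trans hmono
  rw [Measure.addHaar_ball_of_pos _ _ (by positivity), finrank_euclideanSpace_fin] at hle
  have hreal := ENNReal.toReal_mono (measure_ne_top μ _) hle
  rw [ENNReal.toReal_mul, ENNReal.toReal_mul, ENNReal.toReal_ofReal hc.le,
    ENNReal.toReal_ofReal (by positivity)] at hreal
  refine le_trans (le_of_eq ?_) hreal
  rw [Real.rpow_natCast, ht]
  simp only [w, Measure.real, div_pow, mul_pow]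
  ring

/-! ### The limit theorem -/

/-- By the Borel–Cantelli lemma, the rate holds almost surely. -/
lemma HasArchetypeRate.ae_isBigO {d k : ℕ} {μ : Measure (Euc d)} {Astar : Fin k → Euc d}
    {α C : ℝ} (h : HasArchetypeRate.{u} μ Astar α C) (hstar : IsArchetype μ Astar)
    {Ω : Type u} [MeasurableSpace Ω] {P : Measure Ω} [IsProbabilityMeasure P]
    {X : ℕ → Ω → Euc d} {A : ℕ → Ω → Fin k → Euc d} (hX : IsIIDSample μ P X)
    (hA : IsArchetypeChoice X A) :
    ∀ᵐ ω ∂P, (fun N => archObjective μ (A N ω) - archObjective μ Astar)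
      =O[atTop] (fun N : ℕ => (Real.log N / N) ^ (1 / α)) := by
  obtain ⟨N, hN⟩ := h
  let s : ℕ → Set Ω := fun n => {ω | N < n ∧ ¬ (archObjective μ (A n ω) - archObjective μ Astar
    ≤ C * (Real.log n / n) ^ (1 / α))}
  have hs : ∀ n, P (s n) ≤ ENNReal.ofReal (4 / (n : ℝ) ^ 2) := by
    intro n
    by_cases hn : N < n
    · refine (measure_mono fun ω hω => ?_).trans (hN Ω P X A hX hA n hn)
      simp only [s, Set.mem_ofPred_eq] at hω ⊢
      exact hω.2
    · have : s n = ∅ := by ext ω; simp [s, hn]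
      rw [this, measure_empty]
      exact zero_le
  have hsum : (∑' n, P (s n)) ≠ ⊤ := by
    refine ne_top_of_le_ne_top ?_ (ENNReal.tsum_le_tsum hs)
    refine Summable.tsum_ofReal_ne_top ?_
    exact (Real.summable_one_div_nat_pow.2 one_lt_two).mul_left 4 |>.congr fun n => by ring
  filter_upwards [ae_eventually_notMem hsum, hX.ae_mem_support] with ω hω hmem
  refine IsBigO.of_bound C ?_
  filter_upwards [hω, eventually_gt_atTop N, eventually_ge_atTop 1] with n hn hNn hn1
  simp only [s, Set.mem_ofPred_eq, not_and, not_not] at hn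
  have hge := hstar.2 (A n ω) fun l => convexHull_data_subset hmem n ((hA n hn1 ω).1 l)
  rw [Real.norm_of_nonneg (sub_nonneg.2 hge),
    Real.norm_of_nonneg (Real.rpow_nonneg (log_div_nonneg n) _)]
  exact hn hNn

theorem theoremt (d k : ℕ) (hk : 1 ≤ k) (μ : Measure (Euc d)) [IsProbabilityMeasure μ]
    (hμ : IsCompact μ.support) (Astar : Fin k → Euc d) (hstar : IsArchetype μ Astar) :
    -- almost sure convergence of the optimal values
    (∀ (Ω : Type u) [MeasurableSpace Ω] (P : Measure Ω) [IsProbabilityMeasure P]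
      (X : ℕ → Ω → Euc d) (A : ℕ → Ω → Fin k → Euc d),
      IsIIDSample μ P X → IsArchetypeChoice X A →
      ∀ᵐ ω ∂P, Tendsto (fun N => archObjective μ (A N ω)) atTop (𝓝 (archObjective μ Astar))) ∧
    -- rate under the cap condition: the bad event has (outer) probability at most `4 / n ^ 2`
    (∃ C : ℝ, 0 < C ∧ ∀ α L : ℝ, min (d : ℝ) 2 ≤ α →
      ∃ N : ℝ → ℕ, AntitoneOn N (Set.Ioi 0) ∧ ∀ η : ℝ, CapCondition μ α L η →
        ∀ (Ω : Type u) [MeasurableSpace Ω] (P : Measure Ω) [IsProbabilityMeasure P]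
          (X : ℕ → Ω → Euc d) (A : ℕ → Ω → Fin k → Euc d),
          IsIIDSample μ P X → IsArchetypeChoice X A →
          ∀ n : ℕ, N η < n →
            P {ω | ¬ (archObjective μ (A n ω) - archObjective μ Astar
                ≤ C * (Real.log n / n) ^ (1 / α))} ≤ ENNReal.ofReal (4 / (n : ℝ) ^ 2)) ∧
    -- almost sure rate for densities bounded from below on convex sets
    (HasLowerBoundedDensityOnConvex μ →
      ∀ (Ω : Type u) [MeasurableSpace Ω] (P : Measure Ω) [IsProbabilityMeasure P]
        (X : ℕ → Ω → Euc d) (A : ℕ → Ω → Fin k → Euc d),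
        IsIIDSample μ P X → IsArchetypeChoice X A →
        ∀ᵐ ω ∂P, (fun N => archObjective μ (A N ω) - archObjective μ Astar)
          =O[atTop] (fun N : ℕ => (Real.log N / N) ^ (1 / (d : ℝ)))) := by
  have hbdd : Bornology.IsBounded μ.support := hμ.isBounded
  refine ⟨?_, ?_, ?_⟩
  · intro Ω _ P _ X A hX hA
    exact hX.ae_tendsto_archObjective hk hbdd hstar hA
  · obtain ⟨C, hC, hrate⟩ := exists_uniform_hasArchetypeRate.{u} hk hstar
    refine ⟨C, hC, fun α L hα => ?_⟩
    by_cases hex : ∃ L η, CapCondition μ α L η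
    · -- The threshold is that of the rate of `μ` at the exponent `α`, which involves no `η`.
      obtain ⟨N, hN⟩ := hrate α hα hex
      exact ⟨fun _ => N, antitoneOn_const, fun η _ => hN⟩
    · exact ⟨fun _ => 0, antitoneOn_const, fun η hcap => absurd ⟨L, η, hcap⟩ hex⟩
  · intro hdens Ω _ P _ X A hX hA
    rcases Nat.eq_zero_or_pos d with rfl | hd
    · refine ae_of_all _ fun ω => ?_
      have : (fun N => archObjective μ (A N ω) - archObjective μ Astar) = fun _ => 0 := by
        funext N
        rw [Subsingleton.elim (A N ω) Astar, sub_self]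
      rw [this]
      exact isBigO_zero _ _
    · obtain ⟨L, η, hcap⟩ := hdens.exists_capCondition hd hbdd
      obtain ⟨C, -, hrate⟩ := exists_hasArchetypeRate.{u} hk hstar (min_le_left _ _) hcap
      exact hrate.ae_isBigO hstar hX hA
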